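/- Let $(M,d)$ be a complete metric space and $1\le p<\infty$. Let $\mathcal P(M)$ be the set of Borel probability measures $\mu$ on $M$ with $\mu(\operatorname{supp}\mu)=1$, and let $\mathcal P^p(M)$ be the set of $\mu\in\mathcal P(M)$ with $\int_M d(x,y)^p\,d\mu(y)<\infty$ for some $x\in M$. For $\mu,\nu\in\mathcal P^p(M)$ let $d_p^W(\mu,\nu)=\bigl[\inf_{\pi}\int_{M\times M}d(x,y)^p\,d\pi(x,y)\bigr]^{1/p}$ be the $p$-Wasserstein distance, the infimum being over all $\pi\in\mathcal P(M\times M)$ with marginals $\mu$ and $\nu$. Let $\beta:\mathcal P^p(M)\to M$ be a $p$-contractive barycentric map, i.e. $\beta(\delta_x)=x$ for all $x\in M$ and $d(\beta(\mu),\beta(\nu))\le d_p^W(\mu,\nu)$ for all $\mu,\nu\in\mathcal P^p(M)$. Let $(\Omega,\mathcal A,\mathbf P)$ be a probability space with $(\Omega,\mathcal A)$ standard Borel, and let $T:\Omega\to\Omega$ be a measurable map preserving $\mathbf P$. Let $L^p(\Omega;M)$ be the set of Borel measurable $\varphi:\Omega\to M$ that are a.e. limits of simple functions and satisfy $\int_\Omega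 d(x,\varphi(\omega))^p\,d\mathbf P(\omega)<\infty$ for some $x\in M$, with a.e. equal functions identified, and put $\mathbf d_p(\varphi,\psi)=\bigl[\int_\Omega d(\varphi,\psi)^p\,d\mathbf P\bigr]^{1/p}$. For $\varphi\in L^p(\Omega;M)$ and $n\ge1$ let $\mu_n^\varphi(\omega)=\frac1n\sum_{k=0}^{n-1}\delta_{\varphi(T^k\omega)}$. An ergodic limit map is a map $\Gamma$ from $L^p(\Omega;M)$ onto $\{\varphi\in L^p(\Omega;M):\varphi\circ T=\varphi\}$ such that, for all $\varphi,\psi\in L^p(\Omega;M)$: (i) $d(\beta(\mu_n^\varphi(\omega)),\Gamma(\varphi)(\omega))\to0$ for a.e. $\omega$; (ii) $\mathbf d_p(\beta(\mu_n^\varphi),\Gamma(\varphi))\to0$; (iii) $\mathbf d_p(\Gamma(\varphi),\Gamma(\psi))\le\mathbf d_p(\varphi,\psi)$. Let $\mathcal I=\{A\in\mathcal A:T^{-1}A=A\}$. A disintegration of $\mathbf P$ with respect to $\mathcal I$ is a family $(\mathbf P_\omega)_{\omega\in\Omega}$ of probability measures on $(\Omega,\mathcal A)$ such that, for every $A\in\mathcal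 A$, the function $\omega\mapsto\mathbf P_\omega(A)$ is $\mathcal I$-measurable and is a conditional expectation of $\mathbf 1_A$ with respect to $\mathcal I$. Then an ergodic limit map $\Gamma$ exists, and a disintegration of $\mathbf P$ with respect to $\mathcal I$ exists. Moreover, for every ergodic limit map $\Gamma$, every disintegration $(\mathbf P_\omega)_{\omega\in\Omega}$ of $\mathbf P$ with respect to $\mathcal I$ and every $\varphi\in L^p(\Omega;M)$, one has $\varphi_*\mathbf P_\omega\in\mathcal P^p(M)$ for $\mathbf P$-a.e. $\omega$, and $\Gamma(\varphi)$ is the $\beta$-conditional expectation of $\varphi$ with respect to $\mathcal I$: $$\Gamma(\varphi)(\omega)=E^\beta_{\mathcal I}(\varphi)(\omega):=\beta(\varphi_*\mathbf P_\omega)\qquad\text{for }\mathbf P\text{-a.e. }\omega\in\Omega .$$ -/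

import Mathlib

open MeasureTheory Filter Topology
open scoped ENNReal

noncomputable section

namespace Barycentric

/-- The set `P^p(M)`: Borel probability measures of full support mass (that is, `μ (supp μ) = 1`)
with `∫ d(x, y)^p dμ(y) < ∞` for some `x`. -/
def Pp (M : Type*) [MetricSpace M] [MeasurableSpace M] (p : ℝ) : Set (Measure M) :=
  {μ | IsProbabilityMeasure μ ∧ μ μ.support = 1 ∧ ∃ x : M, ∫⁻ y, edist x y ^ p ∂μ < ∞}

/-- The couplings `Π(μ, ν)`: probability measures on the Borel sets of `M × M`, with
`π (supp π) = 1`, whose marginals are `μ` and `ν`. (When `M` is not separable, the Borel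
`σ`-algebra of `M × M` may be larger than the product `σ`-algebra, hence the explicit `borel`.) -/
def couplings {M : Type*} [MetricSpace M] [MeasurableSpace M] (μ ν : Measure M) :
    Set (@Measure (M × M) (borel (M × M))) :=
  letI : MeasurableSpace (M × M) := borel (M × M)
  {π | IsProbabilityMeasure π ∧ π π.support = 1 ∧
    ∀ B : Set M, MeasurableSet B → π (B ×ˢ Set.univ) = μ B ∧ π (Set.univ ×ˢ B) = ν B}

/-- The `p`-Wasserstein distance `d_p^W`, with values in `[0, ∞]`. -/
def wasserstein {M : Type*} [MetricSpace M] [MeasurableSpace M] (p : ℝ) (μ ν : Measure M) :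
    ℝ≥0∞ :=
  letI : MeasurableSpace (M × M) := borel (M × M)
  (⨅ π ∈ couplings μ ν, ∫⁻ z, edist z.1 z.2 ^ p ∂π) ^ (1 / p)

theorem mem_support_of_singleton {M : Type*} [MetricSpace M] [MeasurableSpace M]
    {μ : Measure M} {x : M} (h : 0 < μ {x}) : x ∈ μ.support := by
  rw [Measure.mem_support_iff_forall]
  intro U hU
  exact h.trans_le (measure_mono (Set.singleton_subset_iff.2 (mem_of_mem_nhds hU)))

theorem dirac_mem_Pp {M : Type*} [MetricSpace M] [MeasurableSpace M] [BorelSpace M]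
    {p : ℝ} (hp : 1 ≤ p) (x : M) : Measure.dirac x ∈ Pp M p := by
  refine ⟨inferInstance, ?_, x, ?_⟩
  · rw [Measure.dirac_apply_of_mem]
    exact mem_support_of_singleton (by simp)
  · rw [lintegral_dirac]
    simp [ENNReal.zero_rpow_of_pos (zero_lt_one.trans_le hp)]

/-- The empirical measure `μ_n^φ(ω) = (1/n) ∑_{k < n} δ_{φ (T^k ω)}`. -/
def empiricalMeasure {Ω M : Type*} [MeasurableSpace M] (T : Ω → Ω) (φ : Ω → M) (n : ℕ) (ω : Ω) :
    Measure M :=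
  (n : ℝ≥0∞)⁻¹ • ∑ k ∈ Finset.range n, Measure.dirac (φ (T^[k] ω))

theorem empiricalMeasure_mem_Pp {Ω M : Type*} [MetricSpace M] [MeasurableSpace M] [BorelSpace M]
    {p : ℝ} (hp : 1 ≤ p) (T : Ω → Ω) (φ : Ω → M) (n : ℕ) (ω : Ω) :
    empiricalMeasure T φ (n + 1) ω ∈ Pp M p := by
  have hp0 : 0 < p := zero_lt_one.trans_le hp
  have hn0 : ((n + 1 : ℕ) : ℝ≥0∞) ≠ 0 := by simp
  have hnt : ((n + 1 : ℕ) : ℝ≥0∞) ≠ ∞ := ENNReal.natCast_ne_top _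
  have hprob : IsProbabilityMeasure (empiricalMeasure T φ (n + 1) ω) := by
    constructor
    simp only [empiricalMeasure, Measure.smul_apply, Measure.finsetSum_apply, measure_univ,
      Finset.sum_const, Finset.card_range, smul_eq_mul, nsmul_eq_mul, mul_one]
    exact ENNReal.inv_mul_cancel hn0 hnt
  refine ⟨hprob, ?_, φ ω, ?_⟩
  · have hmem : ∀ k ∈ Finset.range (n + 1),
        φ (T^[k] ω) ∈ (empiricalMeasure T φ (n + 1) ω).support := by
      intro k hk
      apply mem_support_of_singleton
      simp only [empiricalMeasure, Measure.smul_apply, Measure.finsetSum_apply, smul_eq_mul]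
      refine ENNReal.mul_pos (ENNReal.inv_ne_zero.2 hnt) (ne_of_gt ?_)
      refine lt_of_lt_of_le ?_ (Finset.single_le_sum (fun _ _ => zero_le) hk)
      simp
    refine le_antisymm prob_le_one ?_
    set S := (empiricalMeasure T φ (n + 1) ω).support with hS
    rw [empiricalMeasure, Measure.smul_apply, Measure.finsetSum_apply,
      Finset.sum_congr rfl (fun k hk => Measure.dirac_apply_of_mem (hmem k hk))]
    simp only [Finset.sum_const, Finset.card_range, smul_eq_mul, nsmul_eq_mul, mul_one]
    rw [ENNReal.inv_mul_cancel hn0 hnt]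
  · rw [empiricalMeasure, lintegral_smul_measure, lintegral_finsetSum_measure]
    simp only [lintegral_dirac, smul_eq_mul]
    refine ENNReal.mul_lt_top (ENNReal.inv_lt_top.2 (pos_iff_ne_zero.2 hn0)) ?_
    exact ENNReal.sum_lt_top.2 fun k _ =>
      ENNReal.rpow_lt_top_of_nonneg hp0.le (edist_ne_top _ _)

/-- `β : P^p(M) → M` is a `p`-contractive barycentric map. -/
structure IsContractiveBarycentric {M : Type*} [MetricSpace M] [MeasurableSpace M] [BorelSpace M]
    {p : ℝ} (hp : 1 ≤ p) (β : Pp M p → M) : Prop where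
  apply_dirac : ∀ x : M, β ⟨Measure.dirac x, dirac_mem_Pp hp x⟩ = x
  contractive : ∀ μ ν : Pp M p, edist (β μ) (β ν) ≤ wasserstein p μ.1 ν.1

/-- The `p`-th Bochner integrable functions `L^p(Ω; M)`: Borel measurable and strongly measurable
(almost everywhere limits of simple functions), with `∫ d(x, φ)^p dP < ∞` for some `x`. They are
kept as functions; statements below identify them up to almost everywhere equality. -/
def BochnerLp {Ω : Type*} [MeasurableSpace Ω] (M : Type*) [MetricSpace M] [MeasurableSpace M]
    (p : ℝ) (P : Measure Ω) : Set (Ω → M) :=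
  {φ | Measurable φ ∧ AEStronglyMeasurable φ P ∧ ∃ x : M, ∫⁻ ω, edist x (φ ω) ^ p ∂P < ∞}

/-- The `L^p`-distance of two `M`-valued functions, with values in `[0, ∞]`. -/
def distLp {Ω M : Type*} [MeasurableSpace Ω] [MetricSpace M] (p : ℝ) (P : Measure Ω)
    (φ ψ : Ω → M) : ℝ≥0∞ :=
  (∫⁻ ω, edist (φ ω) (ψ ω) ^ p ∂P) ^ (1 / p)

/-- The function `ω ↦ β (μ_{n+1}^φ(ω))`. The index is shifted so that the sequence
`β (μ_1^φ), β (μ_2^φ), …` starts at `n = 0`. -/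
def baryEmpirical {Ω M : Type*} [MetricSpace M] [MeasurableSpace M] [BorelSpace M]
    {p : ℝ} (hp : 1 ≤ p) (β : Pp M p → M) (T : Ω → Ω) (φ : Ω → M) (n : ℕ) (ω : Ω) : M :=
  β ⟨empiricalMeasure T φ (n + 1) ω, empiricalMeasure_mem_Pp hp T φ n ω⟩

/-- `Γ` is the ergodic limit map: it sends `L^p(Ω; M)` onto the `T`-invariant functions in
`L^p(Ω; M)` (up to almost everywhere equality), `β (μ_n^φ) → Γ φ` almost everywhere and in the
`L^p`-distance, and `Γ` does not increase the `L^p`-distance. -/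
structure IsErgodicLimitMap {Ω M : Type*} [MeasurableSpace Ω] [MetricSpace M] [MeasurableSpace M]
    [BorelSpace M] {p : ℝ} (hp : 1 ≤ p) (β : Pp M p → M) (T : Ω → Ω) (P : Measure Ω)
    (Γ : BochnerLp M p P → BochnerLp M p P) : Prop where
  invariant : ∀ φ, (Γ φ).1 ∘ T =ᵐ[P] (Γ φ).1
  onto : ∀ ψ : BochnerLp M p P, ψ.1 ∘ T =ᵐ[P] ψ.1 → ∃ φ, (Γ φ).1 =ᵐ[P] ψ.1
  tendsto_ae : ∀ φ, ∀ᵐ ω ∂P,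
    Tendsto (fun n => baryEmpirical hp β T φ.1 n ω) atTop (𝓝 ((Γ φ).1 ω))
  tendsto_Lp : ∀ φ,
    Tendsto (fun n => distLp p P (baryEmpirical hp β T φ.1 n) (Γ φ).1) atTop (𝓝 0)
  contractive : ∀ φ ψ, distLp p P (Γ φ).1 (Γ ψ).1 ≤ distLp p P φ.1 ψ.1

/-- `(κ ω)_ω` is a disintegration of `P` with respect to the sub-`σ`-algebra `m`: a family of
probability measures such that, for every measurable `A`, the function `ω ↦ κ ω A` is
`m`-measurable and is a conditional expectation of the indicator of `A` with respect to `m`. -/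
structure IsDisintegration {Ω : Type*} (m : MeasurableSpace Ω) [mΩ : MeasurableSpace Ω]
    (P : Measure Ω) (κ : Ω → Measure Ω) : Prop where
  isProbabilityMeasure : ∀ ω, IsProbabilityMeasure (κ ω)
  measurable : ∀ A, MeasurableSet[mΩ] A → Measurable[m] (fun ω => κ ω A)
  ae_eq_condExp : ∀ A, MeasurableSet[mΩ] A →
    (fun ω => (κ ω A).toReal) =ᵐ[P] P[A.indicator (fun _ => (1 : ℝ)) | m]

open Classical in
/-- The `β`-conditional expectation `ω ↦ β (φ_* κ_ω)` with respect to the `σ`-algebra along which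
`κ` is a disintegration. On the (null) set of `ω` where `φ_* κ_ω` is not in `P^p(M)` the value is
irrelevant, and is set to `φ ω`. -/
def betaCondExp {Ω M : Type*} [MeasurableSpace Ω] [MetricSpace M] [MeasurableSpace M]
    {p : ℝ} (β : Pp M p → M) (κ : Ω → Measure Ω) (φ : Ω → M) (ω : Ω) : M :=
  if h : (κ ω).map φ ∈ Pp M p then β ⟨(κ ω).map φ, h⟩ else φ ω

end Barycentric

end

/-! Empirical measures and conditional laws are both pushforwards under `φ` of probability measures
on `Ω`: the orbit measure `orbitMeasure T n ω` and `κ ω`. Barycenters are therefore compared through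
couplings built on `Ω`. Pushing one measure `ν` forward by the pair `(f, g)` bounds the cost by `∫
d(f, g)^p dν` (`wasserstein_map_le`), so replacing `φ` by a simple function `ψ` costs only the
integral of `d(φ, ψ)^p`, under either measure.

For a simple function the two laws live on a finite set. Keeping their common part on the diagonal
and coupling the rest arbitrarily bounds the distance of the barycenters by the mass left over
(`edist_simpleFunc_rpow_le`). This mass tends to zero almost everywhere by the real-valued pointwise
ergodic theorem applied to the fibers of `ψ`. That theorem, `tendsto_birkhoffAverage_ae`, comes from
a maximal inequality, and the limit of the averages is identified with the integral against `κ ω`.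

Letting `n → ∞` and then improving `ψ` gives convergence of the barycenters to `β (φ_* κ_ω)`, almost
everywhere (`tendsto_baryExt_ae`) and in `L^p` (`tendsto_lintegral_baryExt`). The limit satisfies
all requirements on an ergodic limit map, and uniqueness of limits forces every such map to agree
with it almost everywhere. -/

open MeasureTheory Filter Topology
open scoped ENNReal

noncomputable section

namespace Barycentric

/-! ### Maximal ergodic inequality -/

/-- The running maxima `max_{1 ≤ k ≤ n + 1} S_k g` of the Birkhoff sums of `g`, by recursion. -/
def birkhoffMax {Ω : Type*} (T : Ω → Ω) (g : Ω → ℝ) : ℕ → Ω → ℝ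
  | 0 => g
  | n + 1 => fun ω => g ω + max 0 (birkhoffMax T g n (T ω))

section BirkhoffMax

variable {Ω : Type*} {T : Ω → Ω} {g : Ω → ℝ}

theorem birkhoffMax_succ (n : ℕ) (ω : Ω) :
    birkhoffMax T g (n + 1) ω = g ω + max 0 (birkhoffMax T g n (T ω)) := rfl

theorem birkhoffMax_le_succ (n : ℕ) (ω : Ω) :
    birkhoffMax T g n ω ≤ birkhoffMax T g (n + 1) ω := by
  induction n generalizing ω with
  | zero => simp [birkhoffMax]
  | succ n ih =>
    rw [birkhoffMax_succ, birkhoffMax_succ]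
    have := ih (T ω)
    gcongr

theorem birkhoffMax_mono (ω : Ω) : Monotone fun n => birkhoffMax T g n ω :=
  monotone_nat_of_le_succ fun n => birkhoffMax_le_succ n ω

theorem birkhoffSum_le_birkhoffMax (n : ℕ) (ω : Ω) :
    birkhoffSum T g (n + 1) ω ≤ birkhoffMax T g n ω := by
  induction n generalizing ω with
  | zero => simp [birkhoffMax]
  | succ n ih =>
    rw [birkhoffMax_succ, birkhoffSum_succ']
    have := (ih (T ω)).trans (le_max_right 0 _)
    gcongr

variable [MeasurableSpace Ω] {P : Measure Ω}

theorem measurable_birkhoffMax (hT : Measurable T) (hg : Measurable g) (n : ℕ) :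
    Measurable (birkhoffMax T g n) := by
  induction n with
  | zero => exact hg
  | succ n ih => exact hg.add (measurable_const.max (ih.comp hT))

theorem integrable_birkhoffMax (hT : MeasurePreserving T P P) (hg : Integrable g P) (n : ℕ) :
    Integrable (birkhoffMax T g n) P := by
  induction n with
  | zero => exact hg
  | succ n ih =>
    refine hg.add ?_
    simpa [max_comm] using (hT.integrable_comp_of_integrable ih).pos_part

/-- The set where the Birkhoff sums of `g` are not bounded above. -/
def birkhoffUnbounded (T : Ω → Ω) (g : Ω → ℝ) : Set Ω :=
  {ω | ∀ C : ℕ, ∃ n, (C : ℝ) < birkhoffMax T g n ω}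

/-- The recursion changes the maxima only by the finite amount `g ω` when passing from `T ω` to `ω`,
so unboundedness is exactly invariant, not just up to a null set. The levels `C` are nonnegative,
which rules out the value `0` in `max 0 _`. -/
theorem measurableSet_birkhoffUnbounded (hT : Measurable T) (hg : Measurable g) :
    MeasurableSet[MeasurableSpace.invariants T] (birkhoffUnbounded T g) := by
  refine MeasurableSpace.measurableSet_invariants.2 ⟨?_, ?_⟩
  · simp only [birkhoffUnbounded, Set.ofPred_forall, Set.ofPred_exists]
    exact .iInter fun C => .iUnion fun n =>
      measurableSet_lt measurable_const (measurable_birkhoffMax hT hg n)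
  · ext ω
    simp only [birkhoffUnbounded, Set.mem_preimage, Set.mem_ofPred_eq]
    constructor
    · intro h C
      obtain ⟨D, hD⟩ := exists_nat_gt ((C : ℝ) - g ω)
      obtain ⟨n, hn⟩ := h D
      refine ⟨n + 1, ?_⟩
      rw [birkhoffMax_succ]
      have := le_max_right 0 (birkhoffMax T g n (T ω))
      linarith
    · intro h C
      obtain ⟨D, hD⟩ := exists_nat_gt ((C : ℝ) + g ω)
      obtain ⟨n, hn⟩ := h D
      refine ⟨n, ?_⟩
      have h1 := hn.trans_le (birkhoffMax_le_succ n ω)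
      rw [birkhoffMax_succ] at h1
      have h2 : (C : ℝ) < max 0 (birkhoffMax T g n (T ω)) := by linarith
      rcases lt_max_iff.1 h2 with h3 | h3
      · exact absurd h3 (not_lt.2 C.cast_nonneg)
      · exact h3

/-- The maximal ergodic inequality on the set of unboundedness. -/
theorem setIntegral_birkhoffUnbounded_nonneg (hT : MeasurePreserving T P P) (hgm : Measurable g)
    (hg : Integrable g P) : 0 ≤ ∫ ω in birkhoffUnbounded T g, g ω ∂P := by
  set A := birkhoffUnbounded T g with hA
  obtain ⟨hAm, hAT⟩ := measurableSet_birkhoffUnbounded hT.measurable hgm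
  have hint := integrable_birkhoffMax hT hg
  have hTA : ∀ f : Ω → ℝ, Integrable f P → ∫ ω in A, f (T ω) ∂P = ∫ ω in A, f ω ∂P := by
    intro f hf
    have h1 := (hT.restrict_preimage hAm)
    rw [hAT] at h1
    conv_rhs => rw [← h1.map_eq]
    rw [integral_map hT.measurable.aemeasurable]
    rw [h1.map_eq]; exact hf.aestronglyMeasurable.restrict
  -- The integrand is `birkhoffMax (n + 1) - birkhoffMax n ∘ T`. On `A` the maxima along `T ω` are
  -- eventually positive, so the correction vanishes; it is dominated by `|g ∘ T|` because the
  -- maxima start at `g`.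
  have hlim : Tendsto (fun n => ∫ ω in A, (g ω + max (-birkhoffMax T g n (T ω)) 0) ∂P) atTop
      (𝓝 (∫ ω in A, g ω ∂P)) := by
    refine tendsto_integral_of_dominated_convergence
      (fun ω => |g ω| + |g (T ω)|) (fun n => ?_) ?_ (fun n => ?_) ?_
    · exact (hgm.add (((measurable_birkhoffMax hT.measurable hgm n).comp
        hT.measurable).neg.max measurable_const)).aestronglyMeasurable
    · exact (hg.abs.add (hT.integrable_comp_of_integrable hg).abs).restrict
    · refine .of_forall fun ω => ?_
      have h0 : g (T ω) ≤ birkhoffMax T g n (T ω) := birkhoffMax_mono (T ω) (Nat.zero_le n)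
      have h1 : max (-birkhoffMax T g n (T ω)) 0 ≤ |g (T ω)| :=
        max_le (by linarith [neg_le_abs (g (T ω))]) (abs_nonneg _)
      have h2 : 0 ≤ max (-birkhoffMax T g n (T ω)) 0 := le_max_right _ _
      rw [Real.norm_eq_abs]
      refine (abs_add_le _ _).trans ?_
      rw [abs_of_nonneg h2]
      gcongr
    · refine (ae_restrict_iff' hAm).2 (.of_forall fun ω hω => ?_)
      have hω' : T ω ∈ A := by rw [← hAT] at hω; exact hω
      obtain ⟨N, hN⟩ := hω' 0
      refine tendsto_const_nhds.congr' ?_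
      filter_upwards [eventually_ge_atTop N] with n hn
      have : 0 < birkhoffMax T g n (T ω) := by
        simpa using hN.trans_le (birkhoffMax_mono (T ω) hn)
      rw [max_eq_right (by linarith), add_zero]
  -- By invariance of `A` and of `P`, composition with `T` drops out of the integral, and
  -- monotonicity in `n` makes each term nonnegative.
  refine ge_of_tendsto' hlim fun n => ?_
  have h1 : ∫ ω in A, (g ω + max (-birkhoffMax T g n (T ω)) 0) ∂P
      = ∫ ω in A, (birkhoffMax T g (n + 1) ω - birkhoffMax T g n (T ω)) ∂P := by
    refine integral_congr_ae (.of_forall fun ω => ?_)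
    simp only [birkhoffMax_succ]
    rcases le_total (birkhoffMax T g n (T ω)) 0 with h | h
    · rw [max_eq_left h, max_eq_left (by linarith)]; ring
    · rw [max_eq_right h, max_eq_right (by linarith)]; ring
  rw [h1, integral_sub (g := fun ω => birkhoffMax T g n (T ω)) (hint _).restrict
    (hT.integrable_comp_of_integrable (hint n)).restrict, hTA _ (hint n), sub_nonneg]
  exact setIntegral_mono (hint _).integrableOn (hint _).integrableOn
    fun ω => birkhoffMax_le_succ n ω

end BirkhoffMax

/-! ### Pointwise ergodic theorem for real functions -/

section Pointwise

variable {Ω : Type*} [MeasurableSpace Ω] {P : Measure Ω} [IsFiniteMeasure P] {T : Ω → Ω}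

/-- For `g = f - h - ε / 2`, the integral over the invariant unboundedness set `A` is `-(ε / 2)
P(A)`, yet the maximal inequality makes it nonnegative; hence `P(A) = 0`. Off `A` the sums of `g`
are at most a constant `C`, and `C / (n + 1)` is absorbed by the other `ε / 2`. -/
theorem eventually_birkhoffAverage_lt (hT : MeasurePreserving T P P) {f h : Ω → ℝ}
    (hfm : Measurable f) (hf : Integrable f P) (hhm : Measurable h) (hh : Integrable h P)
    (hhT : h ∘ T = h)
    (hfh : ∀ A, MeasurableSet[MeasurableSpace.invariants T] A →
      ∫ ω in A, f ω ∂P = ∫ ω in A, h ω ∂P) {ε : ℝ} (hε : 0 < ε) :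
    ∀ᵐ ω ∂P, ∀ᶠ n in atTop, birkhoffAverage ℝ T f (n + 1) ω < h ω + ε := by
  set g : Ω → ℝ := fun ω => f ω - h ω - ε / 2 with hgdef
  have hgm : Measurable g := (hfm.sub hhm).sub_const _
  have hg : Integrable g P := (hf.sub hh).sub (integrable_const _)
  have hAinv := measurableSet_birkhoffUnbounded hT.measurable hgm
  have h0 := setIntegral_birkhoffUnbounded_nonneg hT hgm hg
  have h1 : ∫ ω in birkhoffUnbounded T g, g ω ∂P = -(ε / 2) * P.real (birkhoffUnbounded T g) := by
    have : ∀ s : Set Ω, ∫ ω in s, g ω ∂P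
        = ∫ ω in s, f ω ∂P - ∫ ω in s, h ω ∂P - ∫ _ in s, ε / 2 ∂P := fun s => by
      rw [← integral_sub hf.restrict hh.restrict,
        ← integral_sub (f := fun a => f a - h a) (hf.restrict.sub hh.restrict)
          (integrable_const _)]
    rw [this, hfh _ hAinv]
    simp [mul_comm]
  have h2 : P.real (birkhoffUnbounded T g) = 0 := by
    have := measureReal_nonneg (μ := P) (s := birkhoffUnbounded T g)
    nlinarith
  have h3 : P (birkhoffUnbounded T g) = 0 := by
    rwa [measureReal_eq_zero_iff] at h2
  filter_upwards [measure_eq_zero_iff_ae_notMem.1 h3] with ω hω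
  simp only [birkhoffUnbounded, Set.mem_ofPred_eq, not_forall, not_exists, not_lt] at hω
  obtain ⟨C, hC⟩ := hω
  have hlim : Tendsto (fun n : ℕ => (C : ℝ) / ((n : ℝ) + 1)) atTop (𝓝 0) :=
    tendsto_const_div_atTop_nhds_zero_nat (C : ℝ) |>.comp (tendsto_add_atTop_nat 1) |>.congr
      fun n => by simp
  filter_upwards [hlim.eventually_lt_const (half_pos hε)] with n hn
  have hS := (birkhoffSum_le_birkhoffMax (T := T) (g := g) n ω).trans (hC n)
  have hhk : ∀ k, h (T^[k] ω) = h ω := by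
    intro k
    induction k with
    | zero => rfl
    | succ k ih => rw [Function.iterate_succ_apply', ← ih]; exact congrFun hhT _
  have hS' : birkhoffSum T g (n + 1) ω
      = birkhoffSum T f (n + 1) ω - (n + 1) * (h ω + ε / 2) := by
    simp only [birkhoffSum, hgdef, hhk, Finset.sum_sub_distrib, Finset.sum_const,
      Finset.card_range, nsmul_eq_mul]
    push_cast; ring
  rw [hS'] at hS
  have hn1 : (0 : ℝ) < n + 1 := by positivity
  rw [div_lt_iff₀ hn1] at hn
  rw [birkhoffAverage, smul_eq_mul]
  push_cast
  rw [inv_mul_lt_iff₀ hn1]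
  nlinarith

/-- The pointwise ergodic theorem. -/
theorem tendsto_birkhoffAverage_ae (hT : MeasurePreserving T P P) {f h : Ω → ℝ}
    (hfm : Measurable f) (hf : Integrable f P) (hhm : Measurable h) (hh : Integrable h P)
    (hhT : h ∘ T = h)
    (hfh : ∀ A, MeasurableSet[MeasurableSpace.invariants T] A →
      ∫ ω in A, f ω ∂P = ∫ ω in A, h ω ∂P) :
    ∀ᵐ ω ∂P, Tendsto (fun n => birkhoffAverage ℝ T f (n + 1) ω) atTop (𝓝 (h ω)) := by
  have hup : ∀ᵐ ω ∂P, ∀ j : ℕ, ∀ᶠ n in atTop,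
      birkhoffAverage ℝ T f (n + 1) ω < h ω + 1 / ((j : ℝ) + 1) :=
    ae_all_iff.2 fun j => eventually_birkhoffAverage_lt hT hfm hf hhm hh hhT hfh (by positivity)
  have hlow : ∀ᵐ ω ∂P, ∀ j : ℕ, ∀ᶠ n in atTop,
      birkhoffAverage ℝ T (-f) (n + 1) ω < (-h) ω + 1 / ((j : ℝ) + 1) :=
    ae_all_iff.2 fun j => eventually_birkhoffAverage_lt hT hfm.neg hf.neg hhm.neg hh.neg
      (by funext ω; simpa using congrFun hhT ω)
      (fun A hA => by
        simp only [Pi.neg_apply, integral_neg]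
        rw [hfh A hA]) (by positivity)
  filter_upwards [hup, hlow] with ω h1 h2
  rw [Metric.tendsto_atTop']
  intro ε hε
  obtain ⟨j, hj⟩ := exists_nat_one_div_lt hε
  obtain ⟨N, hN⟩ := eventually_atTop.1 ((h1 j).and (h2 j))
  refine ⟨N, fun n hn => ?_⟩
  obtain ⟨h3, h4⟩ := hN n hn.le
  have h5 : birkhoffAverage ℝ T (-f) (n + 1) ω = -birkhoffAverage ℝ T f (n + 1) ω := by
    simp [birkhoffAverage, birkhoffSum]
  rw [h5, Pi.neg_apply] at h4
  rw [Real.dist_eq, abs_lt]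
  constructor <;> linarith

end Pointwise

/-! ### Full support mass from separability -/

section Support

theorem isLindelof_of_isSeparable {X : Type*} [PseudoMetricSpace X] {S : Set X}
    (hS : TopologicalSpace.IsSeparable S) : IsLindelof S := by
  have := hS.secondCountableTopology
  rw [isLindelof_iff_lindelofSpace]
  infer_instance

/-- Every point off the support has a null neighborhood; a separable set is Lindelöf, so countably
many of these cover its part outside the support. -/
theorem measure_support_eq_one_of_isSeparable {X : Type*} [PseudoMetricSpace X]
    [MeasurableSpace X] {μ : Measure X} [IsProbabilityMeasure μ] {S : Set X}
    (hS : TopologicalSpace.IsSeparable S) (h : ∀ᵐ x ∂μ, x ∈ S) [OpensMeasurableSpace X] :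
    μ μ.support = 1 := by
  have hL : IsLindelof (S ∩ μ.supportᶜ) := isLindelof_of_isSeparable (hS.mono Set.inter_subset_left)
  have h0 : (S ∩ μ.supportᶜ)ᶜ ∈ ae μ := by
    refine hL.compl_mem_sets_of_nhdsWithin fun x hx => ?_
    obtain ⟨U, hU, hU0⟩ := Measure.notMem_support_iff_exists.1 hx.2
    exact ⟨U, mem_nhdsWithin_of_mem_nhds hU, compl_mem_ae_iff.2 hU0⟩
  rw [← prob_compl_eq_zero_iff Measure.isClosed_support.measurableSet]
  refine mem_ae_iff.1 ?_
  filter_upwards [h, h0] with x hx hx'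
  by_contra hxs
  exact hx' ⟨hx, hxs⟩

variable {X M : Type*} [MeasurableSpace X] [MetricSpace M] [MeasurableSpace M] [BorelSpace M]

theorem measure_support_map_eq_one {ν : Measure X} [IsProbabilityMeasure ν] {f : X → M}
    (hf : StronglyMeasurable f) : ν.map f (ν.map f).support = 1 := by
  have := Measure.isProbabilityMeasure_map (μ := ν) hf.measurable.aemeasurable
  -- The closure is used because the range itself need not be Borel.
  refine measure_support_eq_one_of_isSeparable hf.isSeparable_range.closure ?_
  have hm : MeasurableSet {x | x ∈ closure (Set.range f)} := isClosed_closure.measurableSet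
  rw [ae_map_iff hf.measurable.aemeasurable hm]
  exact .of_forall fun x => subset_closure (Set.mem_range_self x)

theorem map_mem_Pp {p : ℝ} {ν : Measure X} [IsProbabilityMeasure ν] {f : X → M}
    (hf : StronglyMeasurable f) {x : M} (hx : ∫⁻ a, edist x (f a) ^ p ∂ν < ∞) :
    ν.map f ∈ Pp M p := by
  refine ⟨Measure.isProbabilityMeasure_map hf.measurable.aemeasurable,
    measure_support_map_eq_one hf, x, ?_⟩
  rwa [lintegral_map (by fun_prop) hf.measurable]

end Support

/-! ### Wasserstein estimates by explicit couplings -/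

section Contraction

variable {X M : Type*} [MeasurableSpace X] [MetricSpace M] [MeasurableSpace M] [BorelSpace M]
  {p : ℝ} {hp : 1 ≤ p} {β : Pp M p → M}

/-- The law of `(f, g)` is a coupling. Strong measurability makes the pair measurable for the full
Borel `σ`-algebra of `M × M` and gives its law full support mass. -/
theorem wasserstein_map_le (hp : 1 ≤ p) {ν : Measure X} [IsProbabilityMeasure ν] {f g : X → M}
    (hf : StronglyMeasurable f) (hg : StronglyMeasurable g) :
    wasserstein p (ν.map f) (ν.map g) ^ p ≤ ∫⁻ a, edist (f a) (g a) ^ p ∂ν := by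
  let _ : MeasurableSpace (M × M) := borel (M × M)
  have : BorelSpace (M × M) := ⟨rfl⟩
  have hp0 : p ≠ 0 := by positivity
  have hfg : StronglyMeasurable fun a => (f a, g a) := hf.prodMk hg
  rw [wasserstein, one_div, ENNReal.rpow_inv_rpow hp0]
  have hmem : ν.map (fun a => (f a, g a)) ∈ couplings (ν.map f) (ν.map g) := by
    refine ⟨?_, ?_, fun B hB => ⟨?_, ?_⟩⟩
    · exact Measure.isProbabilityMeasure_map hfg.measurable.aemeasurable
    · exact measure_support_map_eq_one hfg
    · have : MeasurableSet (B ×ˢ (Set.univ : Set M)) := by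
        rw [Set.prod_univ]; exact continuous_fst.measurable hB
      rw [Measure.map_apply hfg.measurable this, Measure.map_apply hf.measurable hB]
      congr 1; ext; simp
    · have : MeasurableSet ((Set.univ : Set M) ×ˢ B) := by
        rw [Set.univ_prod]; exact continuous_snd.measurable hB
      rw [Measure.map_apply hfg.measurable this, Measure.map_apply hg.measurable hB]
      congr 1; ext; simp
  have hcost : Measurable fun z : M × M => edist z.1 z.2 ^ p :=
    (continuous_edist.measurable).pow_const p
  exact (iInf₂_le _ hmem).trans_eq (lintegral_map hcost hfg.measurable)

open Classical in
/-- The extension of `β` to all measures, with an arbitrary value off `P^p(M)`. -/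
def baryExt [Nonempty M] (β : Pp M p → M) (μ : Measure M) : M :=
  if h : μ ∈ Pp M p then β ⟨μ, h⟩ else Classical.arbitrary M

omit [BorelSpace M] in
theorem baryExt_eq [Nonempty M] {μ : Measure M} (h : μ ∈ Pp M p) :
    baryExt β μ = β ⟨μ, h⟩ := dif_pos h

theorem IsContractiveBarycentric.edist_map_rpow_le [Nonempty M]
    (hβ : IsContractiveBarycentric hp β) {ν : Measure X} [IsProbabilityMeasure ν] {f g : X → M}
    (hf : StronglyMeasurable f) (hg : StronglyMeasurable g) (hfP : ν.map f ∈ Pp M p)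
    (hgP : ν.map g ∈ Pp M p) :
    edist (baryExt β (ν.map f)) (baryExt β (ν.map g)) ^ p ≤ ∫⁻ a, edist (f a) (g a) ^ p ∂ν := by
  rw [baryExt_eq hfP, baryExt_eq hgP]
  exact (ENNReal.rpow_le_rpow (hβ.contractive _ _) (by positivity)).trans
    (wasserstein_map_le hp hf hg)

theorem IsContractiveBarycentric.edist_const_rpow_le [Nonempty M]
    (hβ : IsContractiveBarycentric hp β) {ν : Measure X} [IsProbabilityMeasure ν] {f : X → M}
    (hf : StronglyMeasurable f) (hfP : ν.map f ∈ Pp M p) (x : M) :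
    edist x (baryExt β (ν.map f)) ^ p ≤ ∫⁻ a, edist x (f a) ^ p ∂ν := by
  have hx : ν.map (fun _ => x) = Measure.dirac x := by simp [Measure.map_const]
  have hd := dirac_mem_Pp hp x
  have := hβ.edist_map_rpow_le (stronglyMeasurable_const (b := x)) hf (hx ▸ hd) hfP
  rwa [hx, baryExt_eq hd, hβ.apply_dirac] at this

/-- Two probability measures with a common part `ρ` have pushforwards with close barycenters. -/
theorem IsContractiveBarycentric.edist_map_add_rpow_le [Nonempty M]
    (hβ : IsContractiveBarycentric hp β) {ρ ρ₁ ρ₂ : Measure X} [IsProbabilityMeasure (ρ + ρ₁)]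
    [IsProbabilityMeasure (ρ + ρ₂)] {f : X → M} (hf : StronglyMeasurable f)
    (h1 : (ρ + ρ₁).map f ∈ Pp M p) (h2 : (ρ + ρ₂).map f ∈ Pp M p) {D : ℝ≥0∞}
    (hD : ∀ a b, edist (f a) (f b) ^ p ≤ D) :
    edist (baryExt β ((ρ + ρ₁).map f)) (baryExt β ((ρ + ρ₂).map f)) ^ p
      ≤ D * ρ₁ Set.univ := by
  have e1 : ρ Set.univ + ρ₁ Set.univ = 1 := measure_univ (μ := ρ + ρ₁)
  have e2 : ρ Set.univ + ρ₂ Set.univ = 1 := measure_univ (μ := ρ + ρ₂)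
  have hρ : ρ Set.univ ≠ ∞ := ne_top_of_le_ne_top ENNReal.one_ne_top (e1 ▸ le_self_add)
  have hr : ρ₂ Set.univ = ρ₁ Set.univ := (ENNReal.add_right_inj hρ).1 (e2.trans e1.symm)
  have hr1 : ρ₁ Set.univ ≠ ∞ := ne_top_of_le_ne_top ENNReal.one_ne_top (e1 ▸ le_add_self)
  have : IsFiniteMeasure ρ := ⟨hρ.lt_top⟩
  have : IsFiniteMeasure ρ₁ := ⟨hr1.lt_top⟩
  have : IsFiniteMeasure ρ₂ := ⟨(hr ▸ hr1).lt_top⟩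
  set r := ρ₁ Set.univ with hrdef
  -- When `r = 0` the factor `r⁻¹ * r` is `0`, but then `μ` itself vanishes.
  have hcancel : ∀ μ : Measure X, μ Set.univ = r → (r⁻¹ * r) • μ = μ := by
    intro μ hμ
    by_cases h0 : r = 0
    · rw [Measure.measure_univ_eq_zero.1 (hμ.trans h0), smul_zero]
    · rw [ENNReal.inv_mul_cancel h0 hr1, one_smul]
  -- The common part stays on the diagonal at no cost; the remainders, of equal mass `r`, are
  -- coupled by their normalized product.
  set ν : Measure (X × X) := ρ.map (fun a => (a, a)) + r⁻¹ • ρ₁.prod ρ₂ with hν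
  have hdiag : Measurable fun a : X => (a, a) := by fun_prop
  have hfst : ν.map Prod.fst = ρ + ρ₁ := by
    rw [hν, Measure.map_add _ _ measurable_fst, Measure.map_map measurable_fst hdiag,
      Measure.map_smul, Measure.map_fst_prod, hr, smul_smul, hcancel _ rfl]
    congr 1
    exact Measure.map_id
  have hsnd : ν.map Prod.snd = ρ + ρ₂ := by
    rw [hν, Measure.map_add _ _ measurable_snd, Measure.map_map measurable_snd hdiag,
      Measure.map_smul, Measure.map_snd_prod, ← hrdef, smul_smul, hcancel _ hr]
    congr 1
    exact Measure.map_id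
  have hνp : IsProbabilityMeasure ν := by
    constructor
    rw [← Set.preimage_univ (f := (Prod.fst : X × X → X)),
      ← Measure.map_apply measurable_fst .univ, hfst, measure_univ]
  have m1 : ν.map (fun z => f z.1) = (ρ + ρ₁).map f := by
    rw [← hfst, Measure.map_map hf.measurable measurable_fst]; rfl
  have m2 : ν.map (fun z => f z.2) = (ρ + ρ₂).map f := by
    rw [← hsnd, Measure.map_map hf.measurable measurable_snd]; rfl
  have hf1 : StronglyMeasurable fun z : X × X => f z.1 := hf.comp_measurable measurable_fst
  have hf2 : StronglyMeasurable fun z : X × X => f z.2 := hf.comp_measurable measurable_snd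
  have key := hβ.edist_map_rpow_le (ν := ν) hf1 hf2 (m1 ▸ h1) (m2 ▸ h2)
  rw [m1, m2] at key
  refine key.trans ?_
  have hmeas : Measurable fun z : X × X => edist (f z.1) (f z.2) ^ p :=
    (hf1.edist hf2).measurable.pow_const p
  rw [hν, lintegral_add_measure, lintegral_map hmeas hdiag, lintegral_smul_measure]
  simp only [edist_self, ENNReal.zero_rpow_of_pos (zero_lt_one.trans_le hp), lintegral_zero,
    zero_add, smul_eq_mul]
  calc r⁻¹ * ∫⁻ z, edist (f z.1) (f z.2) ^ p ∂ρ₁.prod ρ₂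
      ≤ r⁻¹ * ∫⁻ _, D ∂ρ₁.prod ρ₂ := by
        gcongr with z
        exact hD _ _
    _ = D * r * (r⁻¹ * r) := by
        rw [lintegral_const, ← Set.univ_prod_univ, Measure.prod_prod, hr]; ring
    _ ≤ D * r * 1 := by gcongr; exact ENNReal.inv_mul_le_one r
    _ = D * r := mul_one _

/-- The common part takes the smaller mass at each atom; truncated subtraction gives the two
remainders. -/
theorem exists_common_part {X : Type*} [MeasurableSpace X] [MeasurableSingletonClass X]
    [Fintype X] (ν₁ ν₂ : Measure X) :
    ∃ ρ ρ₁ ρ₂ : Measure X, ν₁ = ρ + ρ₁ ∧ ν₂ = ρ + ρ₂ ∧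
      ρ₁ Set.univ = ∑ a, (ν₁ {a} - ν₂ {a}) := by
  refine ⟨.sum fun a => min (ν₁ {a}) (ν₂ {a}) • Measure.dirac a,
    .sum fun a => (ν₁ {a} - ν₂ {a}) • Measure.dirac a,
    .sum fun a => (ν₂ {a} - ν₁ {a}) • Measure.dirac a, ?_, ?_, ?_⟩
  · rw [Measure.sum_add_sum]
    conv_lhs => rw [← Measure.sum_smul_dirac ν₁]
    congr 1; funext a
    rw [← add_smul, add_comm, tsub_add_min]
  · rw [Measure.sum_add_sum]
    conv_lhs => rw [← Measure.sum_smul_dirac ν₂]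
    congr 1; funext a
    rw [← add_smul, add_comm, min_comm, tsub_add_min]
  · simp

/-- The sum of the distances to the power `p` between the values of a simple function. -/
def simpleDiam (p : ℝ) (ψ : SimpleFunc X M) : ℝ≥0∞ :=
  ∑ x ∈ ψ.range, ∑ y ∈ ψ.range, edist x y ^ p

omit [MeasurableSpace M] [BorelSpace M] in
theorem simpleDiam_ne_top (hp : 1 ≤ p) (ψ : SimpleFunc X M) : simpleDiam p ψ ≠ ∞ :=
  ENNReal.sum_ne_top.2 fun _ _ => ENNReal.sum_ne_top.2 fun _ _ =>
    ENNReal.rpow_ne_top_of_nonneg (by positivity) (edist_ne_top _ _)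

omit [MeasurableSpace M] [BorelSpace M] in
theorem edist_rpow_le_simpleDiam (ψ : SimpleFunc X M) {x y : M} (hx : x ∈ ψ.range)
    (hy : y ∈ ψ.range) : edist x y ^ p ≤ simpleDiam p ψ :=
  (Finset.single_le_sum (f := fun y => edist x y ^ p) (fun _ _ => zero_le) hy).trans
    (Finset.single_le_sum (f := fun x => ∑ y ∈ ψ.range, edist x y ^ p) (fun _ _ => zero_le) hx)

theorem simpleFunc_map_mem_Pp (hp : 1 ≤ p) (ψ : SimpleFunc X M) (ν : Measure X)
    [IsProbabilityMeasure ν] : ν.map ψ ∈ Pp M p := by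
  have : Nonempty X := nonempty_of_isProbabilityMeasure ν
  let a : X := Classical.arbitrary X
  refine map_mem_Pp ψ.stronglyMeasurable (x := ψ a) ?_
  calc ∫⁻ b, edist (ψ a) (ψ b) ^ p ∂ν ≤ ∫⁻ _, simpleDiam p ψ ∂ν :=
        lintegral_mono fun b => edist_rpow_le_simpleDiam ψ (ψ.mem_range_self a) (ψ.mem_range_self b)
    _ < ∞ := by simpa using (simpleDiam_ne_top hp ψ).lt_top

theorem IsContractiveBarycentric.edist_simpleFunc_rpow_le [Nonempty M]
    (hβ : IsContractiveBarycentric hp β) (ψ : SimpleFunc X M) (ν₁ ν₂ : Measure X)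
    [IsProbabilityMeasure ν₁] [IsProbabilityMeasure ν₂] :
    edist (baryExt β (ν₁.map ψ)) (baryExt β (ν₂.map ψ)) ^ p
      ≤ simpleDiam p ψ * ∑ x ∈ ψ.range, (ν₁ (ψ ⁻¹' {x}) - ν₂ (ψ ⁻¹' {x})) := by
  -- Passing to the finite range makes the measures atomic, so that the common part is available.
  let q : X → ψ.range := fun a => ⟨ψ a, ψ.mem_range_self a⟩
  have hq : Measurable q := ψ.measurable.subtype_mk
  have hval : StronglyMeasurable (Subtype.val : ψ.range → M) := .of_discrete
  have hmap : ∀ ν : Measure X, ν.map ψ = (ν.map q).map Subtype.val := fun ν => by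
    rw [Measure.map_map hval.measurable hq]; rfl
  have hp1 := Measure.isProbabilityMeasure_map (μ := ν₁) hq.aemeasurable
  have hp2 := Measure.isProbabilityMeasure_map (μ := ν₂) hq.aemeasurable
  have hm1 := simpleFunc_map_mem_Pp hp ψ ν₁
  have hm2 := simpleFunc_map_mem_Pp hp ψ ν₂
  have hsum : ∑ a : ψ.range, (ν₁.map q {a} - ν₂.map q {a})
      = ∑ x ∈ ψ.range, (ν₁ (ψ ⁻¹' {x}) - ν₂ (ψ ⁻¹' {x})) := by
    rw [← Finset.sum_coe_sort ψ.range]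
    refine Finset.sum_congr rfl fun a _ => ?_
    have : q ⁻¹' {a} = ψ ⁻¹' {a.1} := by ext b; simp [q, Subtype.ext_iff]
    rw [Measure.map_apply hq (measurableSet_singleton a),
      Measure.map_apply hq (measurableSet_singleton a), this]
  rw [hmap] at hm1 hm2
  rw [hmap, hmap, ← hsum]
  obtain ⟨ρ, ρ₁, ρ₂, h1, h2, h3⟩ := exists_common_part (ν₁.map q) (ν₂.map q)
  rw [← h3]
  rw [h1] at hp1 hm1 ⊢
  rw [h2] at hp2 hm2 ⊢
  exact hβ.edist_map_add_rpow_le hval hm1 hm2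
    fun a b => edist_rpow_le_simpleDiam ψ a.2 b.2

end Contraction

/-! ### Integration against a disintegration -/

section Disintegration

variable {Ω : Type*} {m : MeasurableSpace Ω} [mΩ : MeasurableSpace Ω] {P : Measure Ω}
  {κ : Ω → Measure Ω}

theorem IsDisintegration.measurable_measure (hκ : IsDisintegration m P κ) (hm : m ≤ mΩ) :
    Measurable κ :=
  Measure.measurable_of_measurable_coe _ fun A hA => (hκ.measurable A hA).mono hm le_rfl

theorem IsDisintegration.setLIntegral_eq [IsFiniteMeasure P] (hκ : IsDisintegration m P κ)
    (hm : m ≤ mΩ) {A : Set Ω} (hA : MeasurableSet[m] A) {f : Ω → ℝ≥0∞} (hf : Measurable f) :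
    ∫⁻ ω in A, ∫⁻ a, f a ∂κ ω ∂P = ∫⁻ ω in A, f ω ∂P := by
  have hκm := hκ.measurable_measure hm
  -- The defining property of conditional expectation, on sets, is an identity of measures;
  -- integrals of all nonnegative measurable functions follow at once.
  have hbind : (P.restrict A).bind κ = P.restrict A := by
    refine Measure.ext fun s hs => ?_
    rw [Measure.bind_apply hs hκm.aemeasurable]
    have hks : Measurable fun ω => κ ω s := (Measure.measurable_coe hs).comp hκm
    have hle : ∀ ω, κ ω s ≤ 1 := fun ω => by
      have := hκ.isProbabilityMeasure ω
      exact prob_le_one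
    have hfin : ∫⁻ ω in A, κ ω s ∂P ≠ ∞ := by
      refine ne_top_of_le_ne_top (measure_ne_top P A) ?_
      calc ∫⁻ ω in A, κ ω s ∂P ≤ ∫⁻ _ in A, 1 ∂P := lintegral_mono fun ω => hle ω
        _ = P A := by simp
    refine (ENNReal.toReal_eq_toReal_iff' hfin (measure_ne_top _ _)).1 ?_
    rw [← integral_toReal hks.aemeasurable
      (.of_forall fun ω => (hle ω).trans_lt ENNReal.one_lt_top),
      integral_congr_ae (ae_restrict_of_ae (hκ.ae_eq_condExp s hs)),
      setIntegral_condExp hm ((integrable_const _).indicator hs) hA, integral_indicator hs]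
    simp [Measure.real]
  conv_rhs => rw [← hbind]
  rw [Measure.lintegral_bind hκm.aemeasurable hf.aemeasurable]

theorem IsDisintegration.lintegral_eq [IsFiniteMeasure P] (hκ : IsDisintegration m P κ)
    (hm : m ≤ mΩ) {f : Ω → ℝ≥0∞} (hf : Measurable f) :
    ∫⁻ ω, ∫⁻ a, f a ∂κ ω ∂P = ∫⁻ ω, f ω ∂P := by
  simpa using hκ.setLIntegral_eq hm MeasurableSet.univ hf

theorem IsDisintegration.measurable_lintegral (hκ : IsDisintegration m P κ) (hm : m ≤ mΩ)
    {f : Ω → ℝ≥0∞} (hf : Measurable f) : Measurable fun ω => ∫⁻ a, f a ∂κ ω :=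
  (Measure.measurable_lintegral hf).comp (hκ.measurable_measure hm)

theorem IsDisintegration.ae_lintegral_lt_top [IsFiniteMeasure P] (hκ : IsDisintegration m P κ)
    (hm : m ≤ mΩ) {f : Ω → ℝ≥0∞} (hf : Measurable f) (hfi : ∫⁻ ω, f ω ∂P ≠ ∞) :
    ∀ᵐ ω ∂P, ∫⁻ a, f a ∂κ ω < ∞ :=
  ae_lt_top (hκ.measurable_lintegral hm hf) (by rwa [hκ.lintegral_eq hm hf])

theorem IsDisintegration.ae_ae_of_ae [IsFiniteMeasure P] (hκ : IsDisintegration m P κ)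
    (hm : m ≤ mΩ) {q : Ω → Prop} (hq : ∀ᵐ ω ∂P, q ω) : ∀ᵐ ω ∂P, ∀ᵐ a ∂κ ω, q a := by
  obtain ⟨N, hsub, hN, hN0⟩ := exists_measurable_superset_of_null (ae_iff.1 hq)
  have h := hκ.lintegral_eq hm (measurable_one.indicator hN)
  simp only [lintegral_indicator_one hN, hN0] at h
  have hκN : Measurable fun ω => κ ω N :=
    (Measure.measurable_coe hN).comp (hκ.measurable_measure hm)
  rw [lintegral_eq_zero_iff hκN] at h
  filter_upwards [h] with ω hω
  exact ae_iff.2 (measure_mono_null hsub hω)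

theorem exists_isDisintegration [StandardBorelSpace Ω] [IsFiniteMeasure P] (hm : m ≤ mΩ) :
    ∃ κ, IsDisintegration m P κ :=
  ⟨fun ω => ProbabilityTheory.condExpKernel P m ω, fun _ => inferInstance,
    fun _ hA => ProbabilityTheory.measurable_condExpKernel hA,
    fun _ hA => ProbabilityTheory.condExpKernel_ae_eq_condExp hm hA⟩

variable {T : Ω → Ω}

/-- Functions measurable for the strictly invariant sets are invariant at every point, so no
exceptional set appears. -/
theorem IsDisintegration.apply_map (hκ : IsDisintegration (MeasurableSpace.invariants T) P κ)
    (ω : Ω) : κ (T ω) = κ ω :=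
  Measure.ext fun A hA =>
    congrFun (MeasurableSpace.comp_eq_of_measurable_invariants (hκ.measurable A hA)) ω

end Disintegration

/-! ### Orbit measures and their limits -/

section Orbit

variable {Ω : Type*} [MeasurableSpace Ω] {T : Ω → Ω}

/-- The empirical measure of the orbit of a point, as a measure on `Ω`. -/
def orbitMeasure (T : Ω → Ω) (n : ℕ) (ω : Ω) : Measure Ω := empiricalMeasure T id (n + 1) ω

theorem lintegral_orbitMeasure (n : ℕ) (ω : Ω) {f : Ω → ℝ≥0∞} (hf : Measurable f) :
    ∫⁻ a, f a ∂orbitMeasure T n ω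
      = ((n + 1 : ℕ) : ℝ≥0∞)⁻¹ * ∑ k ∈ Finset.range (n + 1), f (T^[k] ω) := by
  rw [orbitMeasure, empiricalMeasure, lintegral_smul_measure, lintegral_finsetSum_measure,
    smul_eq_mul]
  simp only [lintegral_dirac' _ hf, id]

instance isProbabilityMeasure_orbitMeasure (n : ℕ) (ω : Ω) :
    IsProbabilityMeasure (orbitMeasure T n ω) := by
  constructor
  rw [← lintegral_one, lintegral_orbitMeasure n ω measurable_const]
  simp only [Finset.sum_const, Finset.card_range, nsmul_eq_mul, mul_one]
  exact ENNReal.inv_mul_cancel (by simp) (ENNReal.natCast_ne_top _)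

theorem map_orbitMeasure {M : Type*} [MeasurableSpace M] (n : ℕ) (ω : Ω) {φ : Ω → M}
    (hφ : Measurable φ) : (orbitMeasure T n ω).map φ = empiricalMeasure T φ (n + 1) ω := by
  refine Measure.ext fun s hs => ?_
  rw [Measure.map_apply hφ hs]
  simp only [orbitMeasure, empiricalMeasure, Measure.smul_apply, Measure.finsetSum_apply,
    Measure.dirac_apply' _ (hφ hs), Measure.dirac_apply' _ hs, id]
  rfl

variable {P : Measure Ω}

theorem measurable_lintegral_orbitMeasure (hT : Measurable T) (n : ℕ) {f : Ω → ℝ≥0∞}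
    (hf : Measurable f) : Measurable fun ω => ∫⁻ a, f a ∂orbitMeasure T n ω := by
  simp only [lintegral_orbitMeasure _ _ hf]
  exact (Finset.measurable_sum _ fun k _ => hf.comp (hT.iterate k)).const_mul _

theorem lintegral_lintegral_orbitMeasure (hT : MeasurePreserving T P P) (n : ℕ) {f : Ω → ℝ≥0∞}
    (hf : Measurable f) : ∫⁻ ω, ∫⁻ a, f a ∂orbitMeasure T n ω ∂P = ∫⁻ ω, f ω ∂P := by
  simp only [lintegral_orbitMeasure _ _ hf]
  have hk : ∀ k, Measurable fun ω => f (T^[k] ω) := fun k => hf.comp (hT.measurable.iterate k)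
  rw [lintegral_const_mul _ (Finset.measurable_sum _ fun k _ => hk k),
    lintegral_finsetSum _ fun k _ => hk k]
  simp only [fun k => (hT.iterate k).lintegral_comp hf]
  rw [Finset.sum_const, Finset.card_range, nsmul_eq_mul, ← mul_assoc,
    ENNReal.inv_mul_cancel (by simp) (ENNReal.natCast_ne_top _), one_mul]

/-- Along almost every orbit, averages of an integrable function converge to its integral with
respect to the disintegration along the invariant sets. -/
theorem IsDisintegration.tendsto_lintegral_orbitMeasure [IsFiniteMeasure P] {κ : Ω → Measure Ω}
    (hκ : IsDisintegration (MeasurableSpace.invariants T) P κ) (hT : MeasurePreserving T P P)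
    {f : Ω → ℝ≥0∞} (hf : Measurable f) (hfin : ∀ ω, f ω ≠ ∞) (hfi : ∫⁻ ω, f ω ∂P ≠ ∞) :
    ∀ᵐ ω ∂P, Tendsto (fun n => ∫⁻ a, f a ∂orbitMeasure T n ω) atTop (𝓝 (∫⁻ a, f a ∂κ ω)) := by
  have hm := MeasurableSpace.invariants_le T
  have hκf := hκ.measurable_lintegral hm hf
  have hκfi : ∫⁻ ω, ∫⁻ a, f a ∂κ ω ∂P ≠ ∞ := by rwa [hκ.lintegral_eq hm hf]
  have hlt := hκ.ae_lintegral_lt_top hm hf hfi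
  have h := tendsto_birkhoffAverage_ae hT (f := fun ω => (f ω).toReal)
    (h := fun ω => (∫⁻ a, f a ∂κ ω).toReal) hf.ennreal_toReal
    (integrable_toReal_of_lintegral_ne_top hf.aemeasurable hfi) hκf.ennreal_toReal
    (integrable_toReal_of_lintegral_ne_top hκf.aemeasurable hκfi)
    (by funext ω; simp only [Function.comp_apply, hκ.apply_map])
    (fun A hA => by
      rw [integral_toReal hf.aemeasurable (.of_forall fun ω => (hfin ω).lt_top),
        integral_toReal hκf.aemeasurable (ae_restrict_of_ae hlt), hκ.setLIntegral_eq hm hA hf])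
  filter_upwards [h, hlt] with ω hω hω'
  have h2 := (ENNReal.continuous_ofReal.tendsto _).comp hω
  rw [ENNReal.ofReal_toReal hω'.ne] at h2
  refine h2.congr fun n => ?_
  rw [lintegral_orbitMeasure n ω hf, Function.comp_apply, birkhoffAverage, birkhoffSum,
    smul_eq_mul, ENNReal.ofReal_mul (by positivity), ENNReal.ofReal_sum_of_nonneg (by simp),
    ENNReal.ofReal_inv_of_pos (by positivity), ENNReal.ofReal_natCast]
  simp only [ENNReal.ofReal_toReal (hfin _)]

end Orbit

/-! ### Limits and powers of distances -/

theorem tendsto_zero_of_le_of_tendsto {u : ℕ → ℝ≥0∞} {v : ℕ → ℕ → ℝ≥0∞} {w : ℕ → ℝ≥0∞}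
    (huv : ∀ k n, u n ≤ v k n) (hv : ∀ k, Tendsto (v k) atTop (𝓝 (w k)))
    (hw : Tendsto w atTop (𝓝 0)) : Tendsto u atTop (𝓝 0) := by
  rw [ENNReal.tendsto_nhds_zero]
  intro ε hε
  obtain ⟨k, hk⟩ := (hw.eventually_lt_const hε).exists
  filter_upwards [(hv k).eventually_lt_const hk] with n hn
  exact (huv k n).trans hn.le

theorem edist_triangle_three_rpow {M : Type*} [PseudoEMetricSpace M] {p : ℝ} (hp : 0 ≤ p)
    (x y z w : M) : edist x w ^ p ≤ 3 ^ p * (edist x y ^ p + edist y z ^ p + edist z w ^ p) := by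
  set m := max (max (edist x y) (edist y z)) (edist z w) with hm
  have h1 : edist x y ≤ m := (le_max_left _ _).trans (le_max_left _ _)
  have h2 : edist y z ≤ m := (le_max_right _ _).trans (le_max_left _ _)
  have h3 : edist z w ≤ m := le_max_right _ _
  have hle : edist x w ≤ 3 * m := by
    calc edist x w ≤ edist x y + edist y z + edist z w := edist_triangle4 _ _ _ _
      _ ≤ m + m + m := by gcongr
      _ = 3 * m := by ring
  have hmp : m ^ p ≤ edist x y ^ p + edist y z ^ p + edist z w ^ p := by
    rcases max_choice (max (edist x y) (edist y z)) (edist z w) with h | h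
    · rcases max_choice (edist x y) (edist y z) with h' | h'
      · rw [hm, h, h', add_assoc]; exact le_self_add
      · rw [hm, h, h', add_right_comm]; exact le_add_self
    · rw [hm, h]; exact le_add_self
  calc edist x w ^ p ≤ (3 * m) ^ p := ENNReal.rpow_le_rpow hle hp
    _ = 3 ^ p * m ^ p := ENNReal.mul_rpow_of_nonneg _ _ hp
    _ ≤ _ := by gcongr

theorem tendsto_of_edist_rpow {M : Type*} [PseudoEMetricSpace M] {p : ℝ} (hp : 0 < p) {u : ℕ → M}
    {x : M} (h : Tendsto (fun n => edist (u n) x ^ p) atTop (𝓝 0)) :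
    Tendsto u atTop (𝓝 x) := by
  rw [tendsto_iff_edist_tendsto_0]
  have := ((ENNReal.continuous_rpow_const (y := p⁻¹)).tendsto 0).comp h
  rw [ENNReal.zero_rpow_of_pos (inv_pos.2 hp)] at this
  exact this.congr fun n => ENNReal.rpow_rpow_inv hp.ne' _

/-! ### Convergence of barycenters for strongly measurable functions -/

section

variable {Ω M : Type*} [mΩ : MeasurableSpace Ω] [MetricSpace M] [MeasurableSpace M] [BorelSpace M]
  {P : Measure Ω} {T : Ω → Ω} {κ : Ω → Measure Ω} {p : ℝ} {hp : 1 ≤ p} {β : Pp M p → M}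
  {φ ψ : Ω → M}

omit [MeasurableSpace M] [BorelSpace M] in
theorem measurable_edist_rpow (hφ : StronglyMeasurable φ) (hψ : StronglyMeasurable ψ) :
    Measurable fun ω => edist (φ ω) (ψ ω) ^ p :=
  (hφ.edist hψ).measurable.pow_const p

theorem exists_simpleFunc_lintegral_edist_lt (hp : 1 ≤ p) (hφ : StronglyMeasurable φ) {x : M}
    (hx : ∫⁻ ω, edist x (φ ω) ^ p ∂P < ∞) {ε : ℝ≥0∞} (hε : 0 < ε) :
    ∃ ψ : SimpleFunc Ω M, ∫⁻ ω, edist (φ ω) (ψ ω) ^ p ∂P < ε := by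
  have hp0 : 0 < p := zero_lt_one.trans_le hp
  -- With `x` as base point, the approximants satisfy `d(φ, ψ) ≤ d(x, φ)`, which is the dominating
  -- function.
  set s : Set M := insert x (Set.range φ)
  have hsep : TopologicalSpace.IsSeparable s := by
    rw [show s = {x} ∪ Set.range φ from Set.insert_eq _ _]
    exact (Set.finite_singleton x).isSeparable.union hφ.isSeparable_range
  have : TopologicalSpace.SeparableSpace s := hsep.separableSpace
  have hxs : x ∈ s := Set.mem_insert _ _
  let f : ℕ → SimpleFunc Ω M := SimpleFunc.approxOn φ hφ.measurable s x hxs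
  have hlim : Tendsto (fun n => ∫⁻ ω, edist (φ ω) (f n ω) ^ p ∂P) atTop (𝓝 (∫⁻ _, 0 ∂P)) := by
    refine tendsto_lintegral_of_dominated_convergence (fun ω => edist x (φ ω) ^ p)
      (fun n => measurable_edist_rpow hφ (f n).stronglyMeasurable) (fun n => ?_) hx.ne ?_
    · refine .of_forall fun ω => ENNReal.rpow_le_rpow ?_ hp0.le
      rw [edist_comm]
      exact SimpleFunc.edist_approxOn_le hφ.measurable hxs ω n
    · refine .of_forall fun ω => ?_
      have h1 : Tendsto (fun n => f n ω) atTop (𝓝 (φ ω)) :=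
        SimpleFunc.tendsto_approxOn hφ.measurable hxs
          (subset_closure (Set.mem_insert_of_mem _ (Set.mem_range_self ω)))
      have h2 := tendsto_iff_edist_tendsto_0.1 h1
      have h3 := ((ENNReal.continuous_rpow_const (y := p)).tendsto 0).comp h2
      rw [ENNReal.zero_rpow_of_pos hp0] at h3
      exact h3.congr fun n => by rw [Function.comp_apply, edist_comm]
  rw [lintegral_zero] at hlim
  obtain ⟨n, hn⟩ := (hlim.eventually_lt_const hε).exists
  exact ⟨f n, hn⟩

theorem IsContractiveBarycentric.edist_rpow_le_of_simpleFunc [Nonempty M]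
    (hβ : IsContractiveBarycentric hp β) (hφ : StronglyMeasurable φ) (ψ : SimpleFunc Ω M)
    {ν₁ ν₂ : Measure Ω} [IsProbabilityMeasure ν₁] [IsProbabilityMeasure ν₂]
    (h1 : ν₁.map φ ∈ Pp M p) (h2 : ν₂.map φ ∈ Pp M p) :
    edist (baryExt β (ν₁.map φ)) (baryExt β (ν₂.map φ)) ^ p ≤
      3 ^ p * (∫⁻ a, edist (φ a) (ψ a) ^ p ∂ν₁ +
        simpleDiam p ψ * ∑ x ∈ ψ.range, (ν₁ (ψ ⁻¹' {x}) - ν₂ (ψ ⁻¹' {x})) +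
        ∫⁻ a, edist (φ a) (ψ a) ^ p ∂ν₂) := by
  refine (edist_triangle_three_rpow (zero_le_one.trans hp) _ (baryExt β (ν₁.map ψ))
    (baryExt β (ν₂.map ψ)) _).trans ?_
  gcongr
  · exact hβ.edist_map_rpow_le hφ ψ.stronglyMeasurable h1 (simpleFunc_map_mem_Pp hp ψ ν₁)
  · exact hβ.edist_simpleFunc_rpow_le ψ ν₁ ν₂
  · rw [edist_comm]
    exact hβ.edist_map_rpow_le hφ ψ.stronglyMeasurable h2 (simpleFunc_map_mem_Pp hp ψ ν₂)

theorem map_orbitMeasure_mem_Pp (hp : 1 ≤ p) (hφ : Measurable φ) (n : ℕ) (ω : Ω) :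
    (orbitMeasure T n ω).map φ ∈ Pp M p := by
  rw [map_orbitMeasure n ω hφ]
  exact empiricalMeasure_mem_Pp hp T φ n ω

/-- The truncated total variation between the laws of a simple function under the orbit measure
and under the disintegration. -/
def simpleDefect (T : Ω → Ω) (κ : Ω → Measure Ω) (ψ : SimpleFunc Ω M) (n : ℕ) (ω : Ω) : ℝ≥0∞ :=
  ∑ x ∈ ψ.range, (orbitMeasure T n ω (ψ ⁻¹' {x}) - κ ω (ψ ⁻¹' {x}))

omit [MetricSpace M] [MeasurableSpace M] [BorelSpace M] in
theorem IsDisintegration.measurable_simpleDefect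
    (hκ : IsDisintegration (MeasurableSpace.invariants T) P κ) (hT : Measurable T)
    (ψ : SimpleFunc Ω M) (n : ℕ) : Measurable (simpleDefect T κ ψ n) := by
  refine Finset.measurable_sum _ fun x _ => Measurable.sub ?_ ?_
  · have := measurable_lintegral_orbitMeasure hT n
      (measurable_one.indicator (ψ.measurableSet_fiber x))
    simpa only [lintegral_indicator_one (ψ.measurableSet_fiber x)] using this
  · exact (Measure.measurable_coe (ψ.measurableSet_fiber x)).comp
      (hκ.measurable_measure (MeasurableSpace.invariants_le T))

omit [MetricSpace M] [MeasurableSpace M] [BorelSpace M] in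
theorem IsDisintegration.tendsto_simpleDefect [IsFiniteMeasure P]
    (hκ : IsDisintegration (MeasurableSpace.invariants T) P κ) (hT : MeasurePreserving T P P)
    (ψ : SimpleFunc Ω M) :
    ∀ᵐ ω ∂P, Tendsto (fun n => simpleDefect T κ ψ n ω) atTop (𝓝 0) := by
  have h : ∀ x ∈ ψ.range, ∀ᵐ ω ∂P,
      Tendsto (fun n => orbitMeasure T n ω (ψ ⁻¹' {x})) atTop (𝓝 (κ ω (ψ ⁻¹' {x}))) := by
    intro x _
    have hs := ψ.measurableSet_fiber x
    have := hκ.tendsto_lintegral_orbitMeasure hT (f := (ψ ⁻¹' {x}).indicator 1)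
      (measurable_one.indicator hs)
      (fun ω => ne_top_of_le_ne_top ENNReal.one_ne_top
        (Set.indicator_le_self' (fun _ _ => zero_le) ω))
      (by rw [lintegral_indicator_one hs]; exact measure_ne_top _ _)
    simpa only [lintegral_indicator_one hs] using this
  filter_upwards [(ae_ball_iff ψ.range.countable_toSet).2 h] with ω hω
  have := hκ.isProbabilityMeasure ω
  have h0 : Tendsto (fun n => simpleDefect T κ ψ n ω) atTop
      (𝓝 (∑ x ∈ ψ.range, (κ ω (ψ ⁻¹' {x}) - κ ω (ψ ⁻¹' {x})))) :=
    tendsto_finsetSum _ fun x hx =>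
      ENNReal.Tendsto.sub (hω x hx) tendsto_const_nhds (.inl (measure_ne_top _ _))
  simpa using h0

omit [MetricSpace M] [MeasurableSpace M] [BorelSpace M] in
theorem IsDisintegration.tendsto_lintegral_simpleDefect [IsFiniteMeasure P]
    (hκ : IsDisintegration (MeasurableSpace.invariants T) P κ) (hT : MeasurePreserving T P P)
    (ψ : SimpleFunc Ω M) :
    Tendsto (fun n => ∫⁻ ω, simpleDefect T κ ψ n ω ∂P) atTop (𝓝 0) := by
  rw [← lintegral_zero (μ := P)]
  refine tendsto_lintegral_of_dominated_convergence (fun _ => ∑ x ∈ ψ.range, 1)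
    (hκ.measurable_simpleDefect hT.measurable ψ)
    (fun n => .of_forall fun ω => Finset.sum_le_sum fun x _ => tsub_le_self.trans prob_le_one)
    ?_ (hκ.tendsto_simpleDefect hT ψ)
  simp [ENNReal.mul_eq_top]

theorem IsDisintegration.ae_map_mem_Pp [IsFiniteMeasure P]
    (hκ : IsDisintegration (MeasurableSpace.invariants T) P κ) (hφ : StronglyMeasurable φ)
    {x : M} (hx : ∫⁻ ω, edist x (φ ω) ^ p ∂P < ∞) :
    ∀ᵐ ω ∂P, (κ ω).map φ ∈ Pp M p := by
  filter_upwards [hκ.ae_lintegral_lt_top (MeasurableSpace.invariants_le T)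
    (measurable_edist_rpow stronglyMeasurable_const hφ) hx.ne] with ω hω
  have := hκ.isProbabilityMeasure ω
  exact map_mem_Pp hφ hω

theorem IsDisintegration.tendsto_baryExt_ae [IsFiniteMeasure P] [Nonempty M]
    (hκ : IsDisintegration (MeasurableSpace.invariants T) P κ) (hT : MeasurePreserving T P P)
    (hβ : IsContractiveBarycentric hp β) (hφ : StronglyMeasurable φ)
    {x : M} (hx : ∫⁻ ω, edist x (φ ω) ^ p ∂P < ∞) :
    ∀ᵐ ω ∂P, Tendsto (fun n => baryExt β ((orbitMeasure T n ω).map φ)) atTop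
      (𝓝 (baryExt β ((κ ω).map φ))) := by
  have hm := MeasurableSpace.invariants_le T
  obtain ⟨δ, hδ, hδsum⟩ := ENNReal.exists_pos_sum_of_countable one_ne_zero ℕ
  -- Summable errors make `∑ₖ ∫ d(φ, ψₖ)^p dκ_ω` finite for almost every `ω`, so its terms tend to
  -- zero pointwise, without passing to a subsequence.
  choose ψ hψ using fun k => exists_simpleFunc_lintegral_edist_lt hp hφ hx
    (ENNReal.coe_pos.2 (hδ k))
  have hg : ∀ k, Measurable fun ω => edist (φ ω) (ψ k ω) ^ p :=
    fun k => measurable_edist_rpow hφ (ψ k).stronglyMeasurable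
  have hsum : ∫⁻ ω, ∑' k, ∫⁻ a, edist (φ a) (ψ k a) ^ p ∂κ ω ∂P ≠ ∞ := by
    rw [lintegral_tsum fun k => (hκ.measurable_lintegral hm (hg k)).aemeasurable]
    simp only [fun k => hκ.lintegral_eq hm (hg k)]
    exact ((ENNReal.tsum_le_tsum fun k => (hψ k).le).trans_lt
      (hδsum.trans ENNReal.one_lt_top)).ne
  have hae := ae_lt_top (.tsum fun k => hκ.measurable_lintegral hm (hg k)) hsum
  have hconv := ae_all_iff.2 fun k => hκ.tendsto_lintegral_orbitMeasure hT (hg k)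
    (fun ω => ENNReal.rpow_ne_top_of_nonneg (zero_le_one.trans hp) (edist_ne_top _ _))
    (hψ k).ne_top
  have hdef := ae_all_iff.2 fun k => hκ.tendsto_simpleDefect hT (ψ k)
  filter_upwards [hae, hconv, hdef, hκ.ae_map_mem_Pp hφ hx] with ω h1 h2 h3 h4
  have := hκ.isProbabilityMeasure ω
  refine tendsto_of_edist_rpow (zero_lt_one.trans_le hp) ?_
  have h3p : (3 : ℝ≥0∞) ^ p ≠ ∞ :=
    ENNReal.rpow_ne_top_of_nonneg (zero_le_one.trans hp) (by simp)
  refine tendsto_zero_of_le_of_tendsto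
    (fun k n => hβ.edist_rpow_le_of_simpleFunc hφ (ψ k)
      (map_orbitMeasure_mem_Pp hp hφ.measurable n ω) h4)
    (fun k => ENNReal.Tendsto.const_mul (((h2 k).add
      (ENNReal.Tendsto.const_mul (h3 k) (.inr (simpleDiam_ne_top hp _)))).add
      tendsto_const_nhds) (.inr h3p)) ?_
  have h5 := ENNReal.tendsto_atTop_zero_of_tsum_ne_top h1.ne
  have h6 := ENNReal.Tendsto.const_mul (h5.add h5) (.inr h3p)
  simpa using h6

theorem IsDisintegration.tendsto_lintegral_baryExt [IsFiniteMeasure P] [Nonempty M]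
    (hκ : IsDisintegration (MeasurableSpace.invariants T) P κ) (hT : MeasurePreserving T P P)
    (hβ : IsContractiveBarycentric hp β) (hφ : StronglyMeasurable φ)
    {x : M} (hx : ∫⁻ ω, edist x (φ ω) ^ p ∂P < ∞) :
    Tendsto (fun n => ∫⁻ ω, edist (baryExt β ((orbitMeasure T n ω).map φ))
      (baryExt β ((κ ω).map φ)) ^ p ∂P) atTop (𝓝 0) := by
  have hm := MeasurableSpace.invariants_le T
  obtain ⟨δ, hδ, hδsum⟩ := ENNReal.exists_pos_sum_of_countable one_ne_zero ℕ
  choose ψ hψ using fun k => exists_simpleFunc_lintegral_edist_lt hp hφ hx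
    (ENNReal.coe_pos.2 (hδ k))
  have hg : ∀ k, Measurable fun ω => edist (φ ω) (ψ k ω) ^ p :=
    fun k => measurable_edist_rpow hφ (ψ k).stronglyMeasurable
  have h3p : (3 : ℝ≥0∞) ^ p ≠ ∞ :=
    ENNReal.rpow_ne_top_of_nonneg (zero_le_one.trans hp) (by simp)
  have hδ0 := ENNReal.tendsto_atTop_zero_of_tsum_ne_top (hδsum.trans ENNReal.one_lt_top).ne
  refine tendsto_zero_of_le_of_tendsto (v := fun k n => 3 ^ p * (∫⁻ ω, edist (φ ω) (ψ k ω) ^ p ∂P +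
      simpleDiam p (ψ k) * ∫⁻ ω, simpleDefect T κ (ψ k) n ω ∂P +
      ∫⁻ ω, edist (φ ω) (ψ k ω) ^ p ∂P)) (fun k n => ?_)
    (fun k => ENNReal.Tendsto.const_mul ((tendsto_const_nhds.add
      (ENNReal.Tendsto.const_mul (hκ.tendsto_lintegral_simpleDefect hT (ψ k))
        (.inr (simpleDiam_ne_top hp _)))).add tendsto_const_nhds) (.inr h3p)) ?_
  -- Integrating the pointwise bound turns both approximation errors into `∫ d(φ, ψₖ)^p dP`, since
  -- orbit measures and `κ` both average back to `P`.
  · have hle : ∀ᵐ ω ∂P, edist (baryExt β ((orbitMeasure T n ω).map φ))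
        (baryExt β ((κ ω).map φ)) ^ p ≤ 3 ^ p * (∫⁻ a, edist (φ a) (ψ k a) ^ p
          ∂orbitMeasure T n ω + simpleDiam p (ψ k) * simpleDefect T κ (ψ k) n ω +
          ∫⁻ a, edist (φ a) (ψ k a) ^ p ∂κ ω) := by
      filter_upwards [hκ.ae_map_mem_Pp hφ hx] with ω h4
      have := hκ.isProbabilityMeasure ω
      exact hβ.edist_rpow_le_of_simpleFunc hφ (ψ k)
        (map_orbitMeasure_mem_Pp hp hφ.measurable n ω) h4
    have m1 := measurable_lintegral_orbitMeasure hT.measurable n (hg k)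
    have m2 := hκ.measurable_simpleDefect hT.measurable (ψ k) n
    have m3 := hκ.measurable_lintegral hm (hg k)
    refine (lintegral_mono_ae hle).trans_eq ?_
    rw [lintegral_const_mul' _ _ h3p,
      lintegral_add_right _ m3, lintegral_add_left m1, lintegral_const_mul _ m2,
      lintegral_lintegral_orbitMeasure hT n (hg k), hκ.lintegral_eq hm (hg k)]
  · have h0 : Tendsto (fun k => ∫⁻ ω, edist (φ ω) (ψ k ω) ^ p ∂P) atTop (𝓝 0) :=
      tendsto_of_tendsto_of_tendsto_of_le_of_le tendsto_const_nhds hδ0 (fun _ => zero_le)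
        fun k => (hψ k).le
    have h6 := ENNReal.Tendsto.const_mul (h0.add h0) (.inr h3p)
    simpa using h6

/-- The barycenter depends only on the tuple of values along the orbit segment, which ranges over a
finite set; no measurability of `β` is needed. -/
theorem stronglyMeasurable_baryExt_orbitMeasure_simpleFunc [Nonempty M] (hT : Measurable T)
    (ψ : SimpleFunc Ω M) (n : ℕ) :
    StronglyMeasurable fun ω => baryExt β ((orbitMeasure T n ω).map ψ) := by
  let q : Ω → Fin (n + 1) → ψ.range := fun ω k => ⟨ψ (T^[k] ω), ψ.mem_range_self _⟩
  have hq : Measurable q :=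
    measurable_pi_lambda _ fun k => (ψ.measurable.comp (hT.iterate k)).subtype_mk
  let H : (Fin (n + 1) → ψ.range) → M := fun c =>
    baryExt β (((n + 1 : ℕ) : ℝ≥0∞)⁻¹ • ∑ k, Measure.dirac (c k).1)
  have hH : StronglyMeasurable H := .of_discrete
  have heq : (fun ω => baryExt β ((orbitMeasure T n ω).map ψ)) = fun ω => H (q ω) := by
    funext ω
    rw [map_orbitMeasure n ω ψ.measurable, empiricalMeasure, Finset.sum_range]
  rw [heq]
  exact hH.comp_measurable hq

theorem IsContractiveBarycentric.stronglyMeasurable_baryExt_orbitMeasure [Nonempty M]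
    (hβ : IsContractiveBarycentric hp β) (hT : Measurable T) (hφ : StronglyMeasurable φ) (n : ℕ) :
    StronglyMeasurable fun ω => baryExt β ((orbitMeasure T n ω).map φ) := by
  have hp0 : 0 < p := zero_lt_one.trans_le hp
  refine stronglyMeasurable_of_tendsto atTop
    (fun j => stronglyMeasurable_baryExt_orbitMeasure_simpleFunc (β := β) hT (hφ.approx j) n) ?_
  refine tendsto_pi_nhds.2 fun ω => tendsto_of_edist_rpow hp0 ?_
  have hle : ∀ j, edist (baryExt β ((orbitMeasure T n ω).map (hφ.approx j)))
      (baryExt β ((orbitMeasure T n ω).map φ)) ^ p ≤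
      ((n + 1 : ℕ) : ℝ≥0∞)⁻¹ * ∑ k ∈ Finset.range (n + 1),
        edist (hφ.approx j (T^[k] ω)) (φ (T^[k] ω)) ^ p := fun j => by
    rw [← lintegral_orbitMeasure (f := fun a => edist (hφ.approx j a) (φ a) ^ p) n ω
      (measurable_edist_rpow (hφ.approx j).stronglyMeasurable hφ)]
    exact hβ.edist_map_rpow_le (hφ.approx j).stronglyMeasurable hφ
      (simpleFunc_map_mem_Pp hp _ _) (map_orbitMeasure_mem_Pp hp hφ.measurable n ω)
  refine tendsto_of_tendsto_of_tendsto_of_le_of_le tendsto_const_nhds ?_ (fun _ => zero_le) hle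
  have hk : ∀ a, Tendsto (fun j => edist (hφ.approx j a) (φ a) ^ p) atTop (𝓝 0) := fun a => by
    have := ((ENNReal.continuous_rpow_const (y := p)).tendsto 0).comp
      (tendsto_iff_edist_tendsto_0.1 (hφ.tendsto_approx a))
    rwa [ENNReal.zero_rpow_of_pos hp0] at this
  have hs := tendsto_finsetSum (Finset.range (n + 1)) fun k _ => hk (T^[k] ω)
  have := ENNReal.Tendsto.const_mul (a := ((n + 1 : ℕ) : ℝ≥0∞)⁻¹) hs
    (.inr (ENNReal.inv_ne_top.2 (by simp)))
  simpa using this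

theorem IsDisintegration.lintegral_edist_baryExt_le [IsFiniteMeasure P] [Nonempty M]
    (hκ : IsDisintegration (MeasurableSpace.invariants T) P κ)
    (hβ : IsContractiveBarycentric hp β) (hφ : StronglyMeasurable φ) (hψ : StronglyMeasurable ψ)
    {x y : M} (hx : ∫⁻ ω, edist x (φ ω) ^ p ∂P < ∞) (hy : ∫⁻ ω, edist y (ψ ω) ^ p ∂P < ∞) :
    ∫⁻ ω, edist (baryExt β ((κ ω).map φ)) (baryExt β ((κ ω).map ψ)) ^ p ∂P
      ≤ ∫⁻ ω, edist (φ ω) (ψ ω) ^ p ∂P := by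
  rw [← hκ.lintegral_eq (MeasurableSpace.invariants_le T) (measurable_edist_rpow hφ hψ)]
  refine lintegral_mono_ae ?_
  filter_upwards [hκ.ae_map_mem_Pp hφ hx, hκ.ae_map_mem_Pp hψ hy] with ω h1 h2
  have := hκ.isProbabilityMeasure ω
  exact hβ.edist_map_rpow_le hφ hψ h1 h2

theorem IsDisintegration.lintegral_edist_const_baryExt_le [IsFiniteMeasure P] [Nonempty M]
    (hκ : IsDisintegration (MeasurableSpace.invariants T) P κ)
    (hβ : IsContractiveBarycentric hp β) (hφ : StronglyMeasurable φ)
    {x : M} (hx : ∫⁻ ω, edist x (φ ω) ^ p ∂P < ∞) :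
    ∫⁻ ω, edist x (baryExt β ((κ ω).map φ)) ^ p ∂P ≤ ∫⁻ ω, edist x (φ ω) ^ p ∂P := by
  rw [← hκ.lintegral_eq (MeasurableSpace.invariants_le T)
    (measurable_edist_rpow stronglyMeasurable_const hφ)]
  refine lintegral_mono_ae ?_
  filter_upwards [hκ.ae_map_mem_Pp hφ hx] with ω h1
  have := hκ.isProbabilityMeasure ω
  exact hβ.edist_const_rpow_le hφ h1 x

end

/-! ### Transfer to almost everywhere classes and the limit map -/

section BochnerLp

variable {Ω M : Type*} [mΩ : MeasurableSpace Ω] [MetricSpace M] [MeasurableSpace M] [BorelSpace M]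
  {P : Measure Ω} {T : Ω → Ω} {κ : Ω → Measure Ω} {p : ℝ} {hp : 1 ≤ p} {β : Pp M p → M}
  {φ ψ : Ω → M}

omit [MeasurableSpace M] [BorelSpace M] in
theorem lintegral_edist_rpow_congr {φ' ψ' : Ω → M} (h : φ =ᵐ[P] φ') (h' : ψ =ᵐ[P] ψ') :
    ∫⁻ ω, edist (φ ω) (ψ ω) ^ p ∂P = ∫⁻ ω, edist (φ' ω) (ψ' ω) ^ p ∂P := by
  refine lintegral_congr_ae ?_
  filter_upwards [h, h'] with ω h1 h2
  rw [h1, h2]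

omit [BorelSpace M] in
theorem exists_stronglyMeasurable_ae_eq (hφ : φ ∈ BochnerLp M p P) :
    ∃ φ', StronglyMeasurable φ' ∧ φ =ᵐ[P] φ' ∧ ∃ x, ∫⁻ ω, edist x (φ' ω) ^ p ∂P < ∞ := by
  obtain ⟨-, hs, x, hx⟩ := hφ
  refine ⟨hs.mk φ, hs.stronglyMeasurable_mk, hs.ae_eq_mk, x, ?_⟩
  rwa [← lintegral_edist_rpow_congr (ae_eq_refl fun _ => x) hs.ae_eq_mk]

/-- Almost every orbit avoids the null set where `φ` and `ψ` differ, because each iterate of `T`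
preserves `P`. -/
theorem baryEmpirical_ae_eq [Nonempty M] (hT : MeasurePreserving T P P)
    (hψ : Measurable ψ) (h : φ =ᵐ[P] ψ) :
    ∀ᵐ ω ∂P, ∀ n, baryEmpirical hp β T φ n ω = baryExt β ((orbitMeasure T n ω).map ψ) := by
  have hall : ∀ᵐ ω ∂P, ∀ k, φ (T^[k] ω) = ψ (T^[k] ω) :=
    ae_all_iff.2 fun k => (hT.iterate k).quasiMeasurePreserving.ae h
  filter_upwards [hall] with ω hω n
  have heq : (orbitMeasure T n ω).map ψ = empiricalMeasure T φ (n + 1) ω := by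
    rw [map_orbitMeasure n ω hψ]
    simp only [empiricalMeasure, hω]
  rw [heq, baryExt_eq (empiricalMeasure_mem_Pp hp T φ n ω)]
  rfl

omit [MetricSpace M] [BorelSpace M] in
theorem IsDisintegration.map_ae_eq [IsFiniteMeasure P]
    (hκ : IsDisintegration (MeasurableSpace.invariants T) P κ) (h : φ =ᵐ[P] ψ) :
    ∀ᵐ ω ∂P, (κ ω).map φ = (κ ω).map ψ := by
  filter_upwards [hκ.ae_ae_of_ae (MeasurableSpace.invariants_le T) h] with ω hω
  exact Measure.map_congr hω

theorem IsDisintegration.ae_map_mem_Pp_of_mem_BochnerLp [IsFiniteMeasure P]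
    (hκ : IsDisintegration (MeasurableSpace.invariants T) P κ) (hφ : φ ∈ BochnerLp M p P) :
    ∀ᵐ ω ∂P, (κ ω).map φ ∈ Pp M p := by
  obtain ⟨φ', hs, heq, x, hx⟩ := exists_stronglyMeasurable_ae_eq hφ
  filter_upwards [hκ.map_ae_eq heq, hκ.ae_map_mem_Pp hs hx] with ω h1 h2
  rwa [h1]

theorem IsDisintegration.betaCondExp_ae_eq [IsFiniteMeasure P] [Nonempty M]
    (hκ : IsDisintegration (MeasurableSpace.invariants T) P κ) (hφ : φ ∈ BochnerLp M p P) :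
    betaCondExp β κ φ =ᵐ[P] fun ω => baryExt β ((κ ω).map φ) := by
  filter_upwards [hκ.ae_map_mem_Pp_of_mem_BochnerLp hφ] with ω h
  rw [betaCondExp, dif_pos h, baryExt_eq h]

theorem IsDisintegration.tendsto_baryEmpirical_ae [IsFiniteMeasure P] [Nonempty M]
    (hκ : IsDisintegration (MeasurableSpace.invariants T) P κ) (hT : MeasurePreserving T P P)
    (hβ : IsContractiveBarycentric hp β) (hφ : φ ∈ BochnerLp M p P) :
    ∀ᵐ ω ∂P, Tendsto (fun n => baryEmpirical hp β T φ n ω) atTop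
      (𝓝 (baryExt β ((κ ω).map φ))) := by
  obtain ⟨φ', hs, heq, x, hx⟩ := exists_stronglyMeasurable_ae_eq hφ
  filter_upwards [hκ.map_ae_eq heq, hκ.tendsto_baryExt_ae hT hβ hs hx,
    baryEmpirical_ae_eq (hp := hp) (β := β) hT hs.measurable heq] with ω h1 h2 h3
  simpa only [h3, h1] using h2

theorem IsDisintegration.tendsto_distLp_baryEmpirical [IsFiniteMeasure P] [Nonempty M]
    (hκ : IsDisintegration (MeasurableSpace.invariants T) P κ) (hT : MeasurePreserving T P P)
    (hβ : IsContractiveBarycentric hp β) (hφ : φ ∈ BochnerLp M p P) :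
    Tendsto (fun n => distLp p P (baryEmpirical hp β T φ n)
      fun ω => baryExt β ((κ ω).map φ)) atTop (𝓝 0) := by
  obtain ⟨φ', hs, heq, x, hx⟩ := exists_stronglyMeasurable_ae_eq hφ
  have h := ((ENNReal.continuous_rpow_const (y := 1 / p)).tendsto 0).comp
    (hκ.tendsto_lintegral_baryExt hT hβ hs hx)
  rw [ENNReal.zero_rpow_of_pos (by positivity)] at h
  refine h.congr fun n => ?_
  rw [Function.comp_apply, distLp]
  congr 1
  refine lintegral_congr_ae ?_
  filter_upwards [hκ.map_ae_eq heq,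
    baryEmpirical_ae_eq (hp := hp) (β := β) hT hs.measurable heq] with ω h1 h3
  rw [h1, h3]

theorem IsDisintegration.aestronglyMeasurable_baryExt [IsFiniteMeasure P] [Nonempty M]
    (hκ : IsDisintegration (MeasurableSpace.invariants T) P κ) (hT : MeasurePreserving T P P)
    (hβ : IsContractiveBarycentric hp β) (hφ : φ ∈ BochnerLp M p P) :
    AEStronglyMeasurable (fun ω => baryExt β ((κ ω).map φ)) P := by
  obtain ⟨φ', hs, heq, x, hx⟩ := exists_stronglyMeasurable_ae_eq hφ
  have h : AEStronglyMeasurable (fun ω => baryExt β ((κ ω).map φ')) P :=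
    aestronglyMeasurable_of_tendsto_ae atTop
      (fun n => (hβ.stronglyMeasurable_baryExt_orbitMeasure hT.measurable hs n).aestronglyMeasurable)
      (hκ.tendsto_baryExt_ae hT hβ hs hx)
  refine h.congr ?_
  filter_upwards [hκ.map_ae_eq heq] with ω h1
  rw [h1]

theorem IsDisintegration.distLp_baryExt_le [IsFiniteMeasure P] [Nonempty M]
    (hκ : IsDisintegration (MeasurableSpace.invariants T) P κ)
    (hβ : IsContractiveBarycentric hp β) (hφ : φ ∈ BochnerLp M p P) (hψ : ψ ∈ BochnerLp M p P) :
    distLp p P (fun ω => baryExt β ((κ ω).map φ)) (fun ω => baryExt β ((κ ω).map ψ))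
      ≤ distLp p P φ ψ := by
  obtain ⟨φ', hs, heq, x, hx⟩ := exists_stronglyMeasurable_ae_eq hφ
  obtain ⟨ψ', hs', heq', y, hy⟩ := exists_stronglyMeasurable_ae_eq hψ
  refine ENNReal.rpow_le_rpow ?_ (by positivity)
  calc ∫⁻ ω, edist (baryExt β ((κ ω).map φ)) (baryExt β ((κ ω).map ψ)) ^ p ∂P
      = ∫⁻ ω, edist (baryExt β ((κ ω).map φ')) (baryExt β ((κ ω).map ψ')) ^ p ∂P := by
        refine lintegral_congr_ae ?_
        filter_upwards [hκ.map_ae_eq heq, hκ.map_ae_eq heq'] with ω h1 h2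
        rw [h1, h2]
    _ ≤ ∫⁻ ω, edist (φ' ω) (ψ' ω) ^ p ∂P := hκ.lintegral_edist_baryExt_le hβ hs hs' hx hy
    _ = ∫⁻ ω, edist (φ ω) (ψ ω) ^ p ∂P := (lintegral_edist_rpow_congr heq heq').symm

theorem IsDisintegration.exists_lintegral_edist_baryExt_lt_top [IsFiniteMeasure P] [Nonempty M]
    (hκ : IsDisintegration (MeasurableSpace.invariants T) P κ)
    (hβ : IsContractiveBarycentric hp β) (hφ : φ ∈ BochnerLp M p P) :
    ∃ x, ∫⁻ ω, edist x (baryExt β ((κ ω).map φ)) ^ p ∂P < ∞ := by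
  obtain ⟨φ', hs, heq, x, hx⟩ := exists_stronglyMeasurable_ae_eq hφ
  refine ⟨x, lt_of_eq_of_lt (lintegral_congr_ae ?_)
    ((hκ.lintegral_edist_const_baryExt_le hβ hs hx).trans_lt hx)⟩
  filter_upwards [hκ.map_ae_eq heq] with ω h1
  rw [h1]

/-- Along almost every orbit `ψ` is constant, so the empirical measure is a Dirac mass. This yields
surjectivity: the limit map fixes invariant functions. -/
theorem IsContractiveBarycentric.baryEmpirical_of_invariant (hβ : IsContractiveBarycentric hp β)
    (hT : MeasurePreserving T P P) (h : ψ ∘ T =ᵐ[P] ψ) :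
    ∀ᵐ ω ∂P, ∀ n, baryEmpirical hp β T ψ n ω = ψ ω := by
  have hall : ∀ᵐ ω ∂P, ∀ k, ψ (T (T^[k] ω)) = ψ (T^[k] ω) :=
    ae_all_iff.2 fun k => (hT.iterate k).quasiMeasurePreserving.ae h
  filter_upwards [hall] with ω hω n
  have hk : ∀ k, ψ (T^[k] ω) = ψ ω := by
    intro k
    induction k with
    | zero => rfl
    | succ k ih => rw [Function.iterate_succ_apply', hω, ih]
  have hdirac : empiricalMeasure T ψ (n + 1) ω = Measure.dirac (ψ ω) := by
    simp only [empiricalMeasure, hk, Finset.sum_const, Finset.card_range]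
    rw [← Nat.cast_smul_eq_nsmul ℝ≥0∞, smul_smul,
      ENNReal.inv_mul_cancel (by simp) (ENNReal.natCast_ne_top _), one_smul]
  refine Eq.trans ?_ (hβ.apply_dirac (ψ ω))
  exact congrArg β (Subtype.ext hdirac)

theorem exists_isErgodicLimitMap [IsFiniteMeasure P]
    (hκ : IsDisintegration (MeasurableSpace.invariants T) P κ) (hT : MeasurePreserving T P P)
    (hβ : IsContractiveBarycentric hp β) [Nonempty M] :
    ∃ Γ, IsErgodicLimitMap hp β T P Γ := by
  have hmeas := fun φ : BochnerLp M p P => hκ.aestronglyMeasurable_baryExt hT hβ φ.2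
  -- `ω ↦ β (φ_* κ_ω)` is only known to be almost everywhere strongly measurable, so a strongly
  -- measurable modification serves as the limit.
  let G : BochnerLp M p P → Ω → M := fun φ => (hmeas φ).mk _
  have hG : ∀ φ, (fun ω => baryExt β ((κ ω).map φ.1)) =ᵐ[P] G φ := fun φ => (hmeas φ).ae_eq_mk
  have hmem : ∀ φ, G φ ∈ BochnerLp M p P := fun φ => by
    obtain ⟨x, hx⟩ := hκ.exists_lintegral_edist_baryExt_lt_top hβ φ.2
    refine ⟨(hmeas φ).stronglyMeasurable_mk.measurable,
      (hmeas φ).stronglyMeasurable_mk.aestronglyMeasurable, x, ?_⟩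
    rwa [← lintegral_edist_rpow_congr (ae_eq_refl fun _ => x) (hG φ)]
  have hae : ∀ φ : BochnerLp M p P, ∀ᵐ ω ∂P,
      Tendsto (fun n => baryEmpirical hp β T φ.1 n ω) atTop (𝓝 (G φ ω)) := fun φ => by
    filter_upwards [hG φ, hκ.tendsto_baryEmpirical_ae hT hβ φ.2] with ω h1 h2
    rwa [← h1]
  refine ⟨fun φ => ⟨G φ, hmem φ⟩, ⟨fun φ => ?_, fun ψ hψ => ⟨ψ, ?_⟩, hae, fun φ => ?_,
    fun φ ψ => ?_⟩⟩
  · filter_upwards [hG φ, hT.quasiMeasurePreserving.ae (hG φ)] with ω h1 h2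
    rw [Function.comp_apply, ← h1, ← h2, hκ.apply_map]
  · filter_upwards [hae ψ, hβ.baryEmpirical_of_invariant hT hψ] with ω h1 h2
    simp only [h2] at h1
    exact tendsto_nhds_unique h1 tendsto_const_nhds
  · refine (hκ.tendsto_distLp_baryEmpirical hT hβ φ.2).congr fun n => ?_
    rw [distLp, distLp, lintegral_edist_rpow_congr (ae_eq_refl _) (hG φ)]
  · refine le_of_eq_of_le ?_ (hκ.distLp_baryExt_le hβ φ.2 ψ.2)
    rw [distLp, distLp, lintegral_edist_rpow_congr (hG φ) (hG ψ)]

end BochnerLp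

end Barycentric

end

theorem theorem4p3 {Ω M : Type*} [MeasurableSpace Ω] [StandardBorelSpace Ω]
    [MetricSpace M] [CompleteSpace M] [MeasurableSpace M] [BorelSpace M]
    (P : Measure Ω) [IsProbabilityMeasure P] (T : Ω → Ω) (hT : MeasurePreserving T P P)
    (p : ℝ) (hp : 1 ≤ p) (β : Barycentric.Pp M p → M)
    (hβ : Barycentric.IsContractiveBarycentric hp β) :
    -- the ergodic limit map exists, and so does a disintegration along the invariant sets
    (∃ Γ, Barycentric.IsErgodicLimitMap hp β T P Γ) ∧
    (∃ κ, Barycentric.IsDisintegration (MeasurableSpace.invariants T) P κ) ∧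
    -- the ergodic limit is the conditional expectation, which is well defined almost everywhere
    ∀ Γ, Barycentric.IsErgodicLimitMap hp β T P Γ →
    ∀ κ, Barycentric.IsDisintegration (MeasurableSpace.invariants T) P κ →
    ∀ φ : Barycentric.BochnerLp M p P,
      (∀ᵐ ω ∂P, (κ ω).map φ.1 ∈ Barycentric.Pp M p) ∧
      (Γ φ).1 =ᵐ[P] Barycentric.betaCondExp β κ φ.1 := by
  have hm := MeasurableSpace.invariants_le T
  obtain ⟨κ₀, hκ₀⟩ := Barycentric.exists_isDisintegration (P := P) hm
  have : Nonempty Ω := nonempty_of_isProbabilityMeasure P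
  have hne : Barycentric.BochnerLp M p P → Nonempty M := fun φ => ⟨φ.1 (Classical.arbitrary Ω)⟩
  refine ⟨?_, ⟨κ₀, hκ₀⟩, fun Γ hΓ κ hκ φ => ⟨hκ.ae_map_mem_Pp_of_mem_BochnerLp φ.2, ?_⟩⟩
  · rcases isEmpty_or_nonempty M with hM | hM
    -- If `M` is empty there are no functions `Ω → M`, as `Ω` carries a probability measure, and
    -- every requirement holds vacuously.
    · have : IsEmpty (Barycentric.BochnerLp M p P) :=
        ⟨fun φ => not_nonempty_iff.2 hM (hne φ)⟩
      exact ⟨id, isEmptyElim, isEmptyElim, isEmptyElim, isEmptyElim, isEmptyElim⟩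
    · exact Barycentric.exists_isErgodicLimitMap hκ₀ hT hβ
  · have := hne φ
    filter_upwards [hΓ.tendsto_ae φ, hκ.tendsto_baryEmpirical_ae hT hβ φ.2,
      hκ.betaCondExp_ae_eq (β := β) φ.2] with ω h1 h2 h3
    rw [h3]
    exact tendsto_nhds_unique h1 h2
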